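/- Let $b>1$ and $d$ be natural numbers and let $q=(q_k)_{k\ge 0}$ be a probability vector with $q_0=0$, $q_1\neq 1$ and $q_k=0$ for all $k>b^d$. Let $m=\sum_k k\,q_k$ be its mean (so $m>1$). Let $\mathbf P_q$ be the law of the Galton–Watson tree with offspring law $q$, that is, the rooted random tree in which the numbers of children of the vertices are i.i.d. with law $q$. Let $\Omega=\{0,1,\dots,b-1\}^d$, and let $\Omega^{<\infty}$ be the $b^d$-ary tree of all finite words over $\Omega$ (the root is the empty word, and the children of a word $w$ are the words $w\omega$ with $\omega\in\Omega$). For a subtree $T'$ of $\Omega^{<\infty}$ containing the root, let $\partial T'\subseteq\Omega^{\mathbb N}$ be the set of infinite words $(\omega_1,\omega_2,\dots)$ all of whose finite prefixes belong to $T'$. Define $\mathcal R(\omega_1,\omega_2,\dots)=\sum_{n\ge 1}b^{-n}\omega_n\in[0,1]^d$. A gauge function is a decreasing (not necessarily strictly) function $g:(0,\infty)\to(0,\infty)$ with $g(0+)=\infty$; put $g(0)=\infty$. The $g$-capacity of a compact set $\Lambda\subseteq\mathbb R^d$ is $$\overline{\mathrm{Cap}}_g(\Lambda)=\Bigl[\inf_{\theta}\iint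 g(|x-y|)\,d\theta(x)\,d\theta(y)\Bigr]^{-1},$$ where $\theta$ ranges over the Borel probability measures on $\mathbb R^d$ with $\theta(\Lambda)=1$ and $|\cdot|$ is the Euclidean norm (with $\infty^{-1}=0$). Then $\mathbf P_q$-almost every tree $T$ has the following property. For every embedding of $T$ as a subtree $T'$ of $\Omega^{<\infty}$ (an injective map of vertices that sends the root to the root and children to children), the set $\Lambda=\mathcal R(\partial T')$ is contained in $[0,1]^d$ and, for every gauge function $g$, $$\overline{\mathrm{Cap}}_g(\Lambda)>0\quad\Longleftrightarrow\quad\sum_{n=1}^\infty m^{-n}\,g(b^{-n})<\infty .$$ -/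

import Mathlib

open MeasureTheory Filter Topology
open scoped ENNReal

namespace GaltonWatson

noncomputable section

/-- The family tree encoded by offspring counts `N` (Ulam-Harris labelling): a vertex is a finite
word, the root is the empty word, and the children of `u` are the words `u ++ [i]`, `i < N u`. -/
def familyTree (N : List ℕ → ℕ) : Set (List ℕ) :=
  {v | ∀ (u : List ℕ) (i : ℕ), u ++ [i] <+: v → i < N u}

/-- The Galton-Watson measure: the numbers of children `N u` are i.i.d. with law `q`.
The random tree is `familyTree N`. -/
def galtonWatsonMeasure (q : PMF ℕ) : Measure (List ℕ → ℕ) :=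
  Measure.infinitePi fun _ : List ℕ => q.toMeasure

/-- The mean of an offspring law. -/
def mean (q : PMF ℕ) : ℝ := ∑' k : ℕ, (k : ℝ) * (q k).toReal

/-- The set of infinite paths from the root in a tree of finite words, each path
being identified with the infinite word whose prefixes are its vertices. -/
def boundary {α : Type*} (T : Set (List α)) : Set (ℕ → α) :=
  {x | ∀ n : ℕ, List.ofFn (fun i : Fin n => x i) ∈ T}

/-- `φ` embeds the rooted tree `T` into the tree of all finite words over `α`: it is
injective on `T`, sends the root to the root and children of `v` to children of `φ v`. -/
structure IsTreeEmbedding {α : Type*} (T : Set (List ℕ)) (φ : List ℕ → List α) : Prop where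
  map_root : φ [] = []
  map_child : ∀ (v : List ℕ) (i : ℕ), v ++ [i] ∈ T → ∃ a : α, φ (v ++ [i]) = φ v ++ [a]
  injOn : Set.InjOn φ T

/-- The base `b` representation map `(ω₁, ω₂, …) ↦ ∑ₙ b⁻ⁿ ωₙ` from sequences of digit vectors
in `{0, …, b-1}ᵈ` to Euclidean space (the sequence is indexed from `0`). -/
def digitMap (b d : ℕ) (ω : ℕ → (Fin d → Fin b)) : EuclideanSpace ℝ (Fin d) :=
  WithLp.toLp 2 fun i => ∑' n : ℕ, ((b : ℝ) ^ (n + 1))⁻¹ * ((ω n i : ℕ) : ℝ)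

/-- A gauge function: a decreasing function `(0, ∞) → (0, ∞)` with `g(0+) = ∞`
(values outside `(0, ∞)` are irrelevant). -/
structure IsGauge (g : ℝ → ℝ) : Prop where
  pos : ∀ t : ℝ, 0 < t → 0 < g t
  antitoneOn : AntitoneOn g (Set.Ioi 0)
  tendsto_zero : Tendsto g (𝓝[>] 0) atTop

/-- The extension of a gauge to `[0, ∞)` by its limit `∞` at `0`. -/
def gaugeKernel (g : ℝ → ℝ) (r : ℝ) : ℝ≥0∞ :=
  if r = 0 then ⊤ else ENNReal.ofReal (g r)

/-- The energy `∫∫ g(|x - y|) dθ(x) dθ(y)`. -/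
def energy {E : Type*} [MetricSpace E] [MeasurableSpace E] (g : ℝ → ℝ) (θ : Measure E) : ℝ≥0∞ :=
  ∫⁻ x, ∫⁻ y, gaugeKernel g (dist x y) ∂θ ∂θ

/-- The capacity of `L` in gauge `g`: the reciprocal of the infimum of the energies of the
probability measures carried by `L`. -/
def capacity {E : Type*} [MetricSpace E] [MeasurableSpace E] (g : ℝ → ℝ) (L : Set E) : ℝ≥0∞ :=
  (⨅ (θ : Measure E) (_ : IsProbabilityMeasure θ) (_ : θ L = 1), energy g θ)⁻¹

end

end GaltonWatson

/-!
Every vertex `u` of the random tree carries the subtree above it, again a Galton-Watson tree, and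
hence the almost sure limit `W(u)` of its normalized generation sizes `Zₙ / mⁿ`. The proof needs
only the following properties of the tree, which hold almost surely and do not involve the gauge or
the embedding (`IsTypical`, `ae_exists_isTypical`): `W` is positive, it is harmonic in the sense
that `m W(u)` is the sum of `W` over the children of `u`, and both `Zₙ` and the sum of `W²` over
generation `n` are `O(mⁿ)`. They come from three facts about the branching recursion.

* Summing a centred square integrable functional over the subtrees of generation `k` multiplies its
  second moment by `mᵏ` only (`integral_iterate_branchSum_sq`), so that after division by `mᵏ` these
  sums are almost surely absolutely summable in `k`. For the centred number of children this is
  convergence of `Zₙ / mⁿ`; for `W² - 𝔼 W²` it is the bound on the sums of squares.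
* `W` has a fourth moment, because `Zₙ / mⁿ` has exponential moments bounded in `n`
  (`exists_exponential_moment`).
* `ℙ(W = 0)` is a fixed point other than `1` of the generating function of an offspring law without
  deaths, hence zero (`ae_martingaleLimit_pos`).

Given a typical tree, the rest is deterministic. The boundary set is covered by the `Z_{n+d}` cubes
of generation `n + d`, whose diameters are at most `b⁻ⁿ`. By the Cauchy-Schwarz inequality, two
independent points with any law `θ` on the set are within distance `b⁻ⁿ` with probability at least
`1 / Z_{n+d}`, which is at least a constant times `m⁻ⁿ`; a layer-cake decomposition of `g` and a
summation by parts turn finite energy into convergence of the series (`summable_of_energy_ne_top`).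
Conversely, let a random path move from `u` to a child `v` with probability `W(v) / (m W(u))`. It
passes through a vertex `u` of generation `n` with probability `m⁻ⁿ W(u) / W([])`. If the image
points of two independent paths are within distance `b⁻ⁿ`, then their cubes of generation `n` are
neighbours, and each cube has at most `5ᵈ` neighbours, so this has probability at most a constant
times `m⁻²ⁿ ∑ W(u)²`, hence at most a constant times `m⁻ⁿ`. The layer-cake bound then makes the
energy of the law of the image point finite (`exists_energy_ne_top`).
-/

namespace GaltonWatson

open ProbabilityTheory Finset

/-! ### Decomposition at the root -/

instance (q : PMF ℕ) : IsProbabilityMeasure (galtonWatsonMeasure q) := by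
  unfold galtonWatsonMeasure; infer_instance

/-- The offspring counts seen from the vertex `u`, which becomes the root. -/
def subtree (u : List ℕ) (N : List ℕ → ℕ) : List ℕ → ℕ := fun v => N (u ++ v)

lemma measurable_subtree (u : List ℕ) : Measurable (subtree u) := by
  unfold subtree; fun_prop

lemma subtree_nil (N : List ℕ → ℕ) : subtree [] N = N := rfl

lemma subtree_append (u v : List ℕ) (N : List ℕ → ℕ) :
    subtree (u ++ v) N = subtree v (subtree u N) := by
  ext w; simp [subtree]

lemma measurePreserving_subtree (q : PMF ℕ) (u : List ℕ) :
    MeasurePreserving (subtree u) (galtonWatsonMeasure q) (galtonWatsonMeasure q) where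
  measurable := measurable_subtree u
  map_eq := Measure.map_infinitePi_infinitePi_of_inj (P := fun _ : List ℕ => q.toMeasure)
    (f := fun v => u ++ v) (List.append_right_injective u)

/-- The offspring counts of the tree whose root has `k` children and carries the trees with
offspring counts `y i` above these. -/
def graft (p : ℕ × (ℕ → List ℕ → ℕ)) : List ℕ → ℕ
  | [] => p.1
  | i :: v => p.2 i v

lemma measurable_graft : Measurable graft := by
  refine measurable_pi_iff.2 fun v => ?_
  cases v with
  | nil => exact measurable_fst
  | cons i v => simp only [graft]; fun_prop

/-- Grafting i.i.d. Galton-Watson trees on an independent first generation gives a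
Galton-Watson tree. -/
lemma map_graft (q : PMF ℕ) :
    (q.toMeasure.prod (Measure.infinitePi fun _ : ℕ => galtonWatsonMeasure q)).map graft =
      galtonWatsonMeasure q := by
  classical
  refine Measure.eq_infinitePi _ fun s t ht => ?_
  have hinj : Function.Injective (fun p : ℕ × List ℕ => p.1 :: p.2) := by
    rintro ⟨i, v⟩ ⟨j, w⟩ h
    simpa using h
  set s' : Finset (ℕ × List ℕ) := s.preimage (fun p => p.1 :: p.2) hinj.injOn with hs'
  set A : Set ℕ := if [] ∈ s then t [] else Set.univ with hA
  set C : Set (ℕ × List ℕ → ℕ) := Set.pi s' (fun p => t (p.1 :: p.2)) with hC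
  have hCm : MeasurableSet C := MeasurableSet.pi s'.countable_toSet fun _ _ => ht _
  have hpre : graft ⁻¹' (Set.pi s t) =
      A ×ˢ ((MeasurableEquiv.curry ℕ (List ℕ) ℕ).symm ⁻¹' C) := by
    ext ⟨k, y⟩
    simp only [Set.mem_preimage, Set.mem_pi, Set.mem_prod, hA, hC, hs']
    constructor
    · intro h
      constructor
      · split_ifs with h0
        · exact h [] h0
        · trivial
      · rintro ⟨i, v⟩ hiv
        have := h (i :: v) (by simpa using hiv)
        simpa [graft] using this
    · rintro ⟨h1, h2⟩ v hv
      cases v with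
      | nil => simpa [graft, show [] ∈ s from hv] using h1
      | cons i v =>
        have := h2 (i, v) (by simpa using hv)
        simpa [graft] using this
  have hm2 : MeasurableSet ((MeasurableEquiv.curry ℕ (List ℕ) ℕ).symm ⁻¹' C) :=
    (MeasurableEquiv.measurable _) hCm
  rw [Measure.map_apply measurable_graft (MeasurableSet.pi s.countable_toSet fun _ _ => ht _),
    hpre, Measure.prod_prod, ← Measure.map_apply (MeasurableEquiv.measurable _) hCm]
  unfold galtonWatsonMeasure
  rw [Measure.infinitePi_map_curry_symm (fun (_ : ℕ) (_ : List ℕ) => q.toMeasure), hC,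
    Measure.infinitePi_pi _ (fun _ _ => ht _)]
  have h3 : ∏ p ∈ s', q.toMeasure (t (p.1 :: p.2)) =
      ∏ v ∈ s.erase [], q.toMeasure (t v) := by
    refine Finset.prod_bij (fun p _ => p.1 :: p.2) ?_ ?_ ?_ ?_
    · intro p hp; simpa [hs'] using hp
    · intro a _ b _ h; exact hinj h
    · intro v hv
      cases v with
      | nil => simp at hv
      | cons i v => exact ⟨(i, v), by simpa [hs'] using hv, rfl⟩
    · intros; rfl
  rw [h3]
  by_cases h0 : [] ∈ s
  · rw [hA, if_pos h0, Finset.mul_prod_erase s (fun v => q.toMeasure (t v)) h0]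
  · rw [hA, if_neg h0, Finset.erase_eq_of_notMem h0]; simp

lemma measurePreserving_graft (q : PMF ℕ) : MeasurePreserving graft
    (q.toMeasure.prod (Measure.infinitePi fun _ : ℕ => galtonWatsonMeasure q))
    (galtonWatsonMeasure q) := ⟨measurable_graft, map_graft q⟩

/-- The branching property for multiplicative functionals, by conditioning on the number of children
of the root. -/
lemma lintegral_prod_subtree (q : PMF ℕ) {F : (List ℕ → ℕ) → ℝ≥0∞} (hF : Measurable F) :
    ∫⁻ N, ∏ i ∈ range (N []), F (subtree [i] N) ∂galtonWatsonMeasure q =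
      ∫⁻ k, (∫⁻ N, F N ∂galtonWatsonMeasure q) ^ k ∂q.toMeasure := by
  have hmeas : Measurable fun p : ℕ × (ℕ → List ℕ → ℕ) => ∏ i ∈ range p.1, F (p.2 i) := by
    refine measurable_from_prod_countable_right fun k => ?_
    exact Finset.measurable_prod (range k) fun i _ => hF.comp (measurable_pi_apply i)
  have hmeas' : Measurable fun N : List ℕ → ℕ => ∏ i ∈ range (N []), F (subtree [i] N) := by
    have := hmeas.comp (f := fun N : List ℕ → ℕ => (N [], fun i => subtree [i] N))
      ((measurable_pi_apply _).prodMk (measurable_pi_iff.2 fun i => measurable_subtree [i]))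
    exact this
  rw [← (measurePreserving_graft q).lintegral_comp hmeas']
  change ∫⁻ p, (fun p : ℕ × (ℕ → List ℕ → ℕ) => ∏ i ∈ range p.1, F (p.2 i)) p ∂_ = _
  rw [lintegral_prod _ hmeas.aemeasurable]
  refine lintegral_congr fun k => ?_
  have hind : iIndepFun (fun (i : ℕ) (y : ℕ → List ℕ → ℕ) => F (y i))
      (Measure.infinitePi fun _ : ℕ => galtonWatsonMeasure q) :=
    iIndepFun_infinitePi (P := fun _ : ℕ => galtonWatsonMeasure q) fun _ => hF
  rw [lintegral_prod_eq_prod_lintegral_of_indepFun (range k) _ hind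
    (fun i => hF.comp (measurable_pi_apply i))]
  have : ∀ i, ∫⁻ y : ℕ → List ℕ → ℕ, F (y i)
      ∂(Measure.infinitePi fun _ : ℕ => galtonWatsonMeasure q) =
      ∫⁻ N, F N ∂galtonWatsonMeasure q := fun i =>
    (measurePreserving_eval_infinitePi (fun _ : ℕ => galtonWatsonMeasure q) i).lintegral_comp hF
  simp [this]

/-- The sum of the functional `f` over the subtrees of the children of the root. -/
noncomputable def branchSum (f : (List ℕ → ℕ) → ℝ) (N : List ℕ → ℕ) : ℝ :=
  ∑ i ∈ range (N []), f (subtree [i] N)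

lemma measurable_branchSum {f : (List ℕ → ℕ) → ℝ} (hf : Measurable f) :
    Measurable (branchSum f) := by
  have hmeas : Measurable fun p : ℕ × (ℕ → List ℕ → ℕ) => ∑ i ∈ range p.1, f (p.2 i) := by
    refine measurable_from_prod_countable_right fun k => ?_
    exact Finset.measurable_sum (range k) fun i _ => hf.comp (measurable_pi_apply i)
  exact hmeas.comp (f := fun N : List ℕ → ℕ => (N [], fun i => subtree [i] N))
      ((measurable_pi_apply _).prodMk (measurable_pi_iff.2 fun i => measurable_subtree [i]))

section moments

variable {q : PMF ℕ} {B : ℕ}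

lemma map_eval_galtonWatsonMeasure (q : PMF ℕ) (v : List ℕ) :
    MeasurePreserving (fun N : List ℕ → ℕ => N v) (galtonWatsonMeasure q) q.toMeasure :=
  measurePreserving_eval_infinitePi (fun _ : List ℕ => q.toMeasure) v

lemma ae_le_offspring (hq : ∀ k, B < k → q k = 0) : ∀ᵐ k ∂q.toMeasure, k ≤ B := by
  have : {k | ¬ k ≤ B} = ⋃ k ∈ {k | B < k}, {k} := by ext; simp
  rw [ae_iff, this, measure_biUnion_null_iff (Set.to_countable _)]
  intro k hk
  rw [PMF.toMeasure_apply_singleton _ _ (measurableSet_singleton _), hq k hk]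

lemma ae_offspring_le (hq : ∀ k, B < k → q k = 0) (v : List ℕ) :
    ∀ᵐ N ∂galtonWatsonMeasure q, N v ≤ B :=
  (map_eval_galtonWatsonMeasure q v).quasiMeasurePreserving.ae (ae_le_offspring hq)

lemma integrable_offspring (hq : ∀ k, B < k → q k = 0) (r : ℕ) :
    Integrable (fun k : ℕ => (k : ℝ) ^ r) q.toMeasure := by
  refine Integrable.of_bound (C := (B : ℝ) ^ r) ?_ ?_
  · exact (measurable_of_countable _).aestronglyMeasurable
  · filter_upwards [ae_le_offspring hq] with k hk
    rw [Real.norm_of_nonneg (by positivity)]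
    gcongr

lemma integral_offspring (hq : ∀ k, B < k → q k = 0) :
    ∫ k : ℕ, (k : ℝ) ∂q.toMeasure = mean q := by
  rw [PMF.integral_eq_tsum _ _ (by simpa using integrable_offspring hq 1)]
  simp [mean, mul_comm]

lemma memLp_branchSum {p : ℝ≥0∞} (hq : ∀ k, B < k → q k = 0) {f : (List ℕ → ℕ) → ℝ}
    (hm : Measurable f) (hf : MemLp f p (galtonWatsonMeasure q)) :
    MemLp (branchSum f) p (galtonWatsonMeasure q) := by
  have h1 : MemLp (fun N => ∑ i ∈ range B, |f (subtree [i] N)|) p (galtonWatsonMeasure q) :=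
    memLp_finsetSum _ fun i _ =>
      (hf.comp_measurePreserving (measurePreserving_subtree q [i])).abs
  refine h1.mono (measurable_branchSum hm).aestronglyMeasurable ?_
  filter_upwards [ae_offspring_le hq []] with N hN
  rw [Real.norm_eq_abs, Real.norm_of_nonneg (by positivity)]
  refine (Finset.abs_sum_le_sum_abs _ _).trans ?_
  exact Finset.sum_le_sum_of_subset_of_nonneg (by simpa using hN) fun _ _ _ => abs_nonneg _

lemma integral_sum_infinitePi {f : (List ℕ → ℕ) → ℝ}
    (hf : Integrable f (galtonWatsonMeasure q)) (k : ℕ) :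
    ∫ y : ℕ → List ℕ → ℕ, ∑ i ∈ range k, f (y i)
      ∂(Measure.infinitePi fun _ : ℕ => galtonWatsonMeasure q) =
      k * ∫ N, f N ∂galtonWatsonMeasure q := by
  have hmp := measurePreserving_eval_infinitePi (fun _ : ℕ => galtonWatsonMeasure q)
  have hint : ∀ i, Integrable (fun y : ℕ → List ℕ → ℕ => f (y i))
      (Measure.infinitePi fun _ : ℕ => galtonWatsonMeasure q) :=
    fun i => (hmp i).integrable_comp_of_integrable hf
  rw [integral_finsetSum _ fun i _ => hint i]
  have : ∀ i, ∫ y : ℕ → List ℕ → ℕ, f (y i)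
      ∂(Measure.infinitePi fun _ : ℕ => galtonWatsonMeasure q) =
      ∫ N, f N ∂galtonWatsonMeasure q := fun i => by
    have h := (hmp i).map_eq
    conv_rhs => rw [← h]
    rw [integral_map (hmp i).measurable.aemeasurable (by rw [h]; exact hf.1)]
  simp [this]

lemma integral_branchSum (hq : ∀ k, B < k → q k = 0) {f : (List ℕ → ℕ) → ℝ}
    (hm : Measurable f) (hf : Integrable f (galtonWatsonMeasure q)) :
    ∫ N, branchSum f N ∂galtonWatsonMeasure q =
      mean q * ∫ N, f N ∂galtonWatsonMeasure q := by
  have hi : Integrable (branchSum f) (galtonWatsonMeasure q) :=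
    memLp_one_iff_integrable.1 (memLp_branchSum hq hm (memLp_one_iff_integrable.2 hf))
  have hmp := measurePreserving_graft q
  have hi' := hmp.integrable_comp_of_integrable hi
  conv_lhs => rw [← hmp.map_eq]
  rw [integral_map hmp.measurable.aemeasurable (by rw [hmp.map_eq]; exact hi.1)]
  rw [integral_prod (fun p => branchSum f (graft p)) hi']
  change ∫ k, ∫ y : ℕ → List ℕ → ℕ, ∑ i ∈ range k, f (y i) ∂_ ∂_ = _
  simp_rw [integral_sum_infinitePi hf]
  rw [integral_mul_const, integral_offspring hq]

/-- Second moments of centred functionals grow like the mean population. -/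
lemma integral_branchSum_sq (hq : ∀ k, B < k → q k = 0) {f : (List ℕ → ℕ) → ℝ}
    (hm : Measurable f) (hf : MemLp f 2 (galtonWatsonMeasure q))
    (h0 : ∫ N, f N ∂galtonWatsonMeasure q = 0) :
    ∫ N, branchSum f N ^ 2 ∂galtonWatsonMeasure q =
      mean q * ∫ N, f N ^ 2 ∂galtonWatsonMeasure q := by
  have hi : Integrable (fun N => branchSum f N ^ 2) (galtonWatsonMeasure q) :=
    (memLp_branchSum hq hm hf).integrable_sq
  have hmp := measurePreserving_graft q
  have hi' := hmp.integrable_comp_of_integrable hi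
  conv_lhs => rw [← hmp.map_eq]
  rw [integral_map hmp.measurable.aemeasurable (by rw [hmp.map_eq]; exact hi.1)]
  rw [integral_prod (fun p => branchSum f (graft p) ^ 2) hi']
  change ∫ k, ∫ y : ℕ → List ℕ → ℕ, (∑ i ∈ range k, f (y i)) ^ 2 ∂_ ∂_ = _
  have hev := measurePreserving_eval_infinitePi (fun _ : ℕ => galtonWatsonMeasure q)
  have key : ∀ k : ℕ, ∫ y : ℕ → List ℕ → ℕ, (∑ i ∈ range k, f (y i)) ^ 2
      ∂(Measure.infinitePi fun _ : ℕ => galtonWatsonMeasure q) =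
      k * ∫ N, f N ^ 2 ∂galtonWatsonMeasure q := by
    intro k
    have hind : iIndepFun (fun (i : ℕ) (y : ℕ → List ℕ → ℕ) => f (y i))
        (Measure.infinitePi fun _ : ℕ => galtonWatsonMeasure q) :=
      iIndepFun_infinitePi (P := fun _ : ℕ => galtonWatsonMeasure q) fun _ => hm
    have hL : ∀ i, MemLp (fun y : ℕ → List ℕ → ℕ => f (y i)) 2
        (Measure.infinitePi fun _ : ℕ => galtonWatsonMeasure q) := fun i =>
      hf.comp_measurePreserving (hev i)
    have hmean : ∀ i, ∫ y : ℕ → List ℕ → ℕ, f (y i)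
        ∂(Measure.infinitePi fun _ : ℕ => galtonWatsonMeasure q) = 0 := fun i => by
      have h := (hev i).map_eq
      rw [← h, integral_map (hev i).measurable.aemeasurable (by rw [h]; exact hf.1)] at h0
      exact h0
    have hvar := IndepFun.variance_sum (s := range k) (fun i _ => hL i)
      (fun i _ j _ hij => hind.indepFun hij)
    have hae : AEMeasurable (∑ i ∈ range k, fun y : ℕ → List ℕ → ℕ => f (y i))
        (Measure.infinitePi fun _ : ℕ => galtonWatsonMeasure q) :=
      Finset.aemeasurable_sum _ fun i _ => (hL i).1.aemeasurable
    rw [variance_of_integral_eq_zero hae] at hvar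
    · simp only [Finset.sum_apply] at hvar
      rw [hvar]
      have : ∀ i, Var[fun y : ℕ → List ℕ → ℕ => f (y i);
          Measure.infinitePi fun _ : ℕ => galtonWatsonMeasure q] =
          ∫ N, f N ^ 2 ∂galtonWatsonMeasure q := fun i => by
        rw [variance_of_integral_eq_zero (hL i).1.aemeasurable (hmean i)]
        have h := (hev i).map_eq
        conv_rhs => rw [← h]
        rw [integral_map (hev i).measurable.aemeasurable
          (by rw [h]; exact (hm.pow_const 2).aestronglyMeasurable)]
      simp [this]
    · simp only [Finset.sum_apply]
      rw [integral_finsetSum _ fun i _ => (hL i).integrable (by norm_num)]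
      simp [hmean]
  simp_rw [key]
  rw [integral_mul_const, integral_offspring hq]

end moments

/-! ### The population martingale -/

section iterate

variable {q : PMF ℕ} {B : ℕ}

lemma measurable_iterate_branchSum {f : (List ℕ → ℕ) → ℝ} (hf : Measurable f) (k : ℕ) :
    Measurable (branchSum^[k] f) := by
  induction k with
  | zero => exact hf
  | succ k ih => rw [Function.iterate_succ_apply']; exact measurable_branchSum ih

lemma memLp_iterate_branchSum {p : ℝ≥0∞} (hq : ∀ k, B < k → q k = 0) {f : (List ℕ → ℕ) → ℝ}
    (hm : Measurable f) (hf : MemLp f p (galtonWatsonMeasure q)) (k : ℕ) :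
    MemLp (branchSum^[k] f) p (galtonWatsonMeasure q) := by
  induction k with
  | zero => exact hf
  | succ k ih =>
    rw [Function.iterate_succ_apply']
    exact memLp_branchSum hq (measurable_iterate_branchSum hm k) ih

lemma integral_iterate_branchSum (hq : ∀ k, B < k → q k = 0) {f : (List ℕ → ℕ) → ℝ}
    (hm : Measurable f) (hf : Integrable f (galtonWatsonMeasure q)) (k : ℕ) :
    ∫ N, branchSum^[k] f N ∂galtonWatsonMeasure q =
      mean q ^ k * ∫ N, f N ∂galtonWatsonMeasure q := by
  induction k with
  | zero => simp
  | succ k ih =>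
    rw [Function.iterate_succ_apply', integral_branchSum hq (measurable_iterate_branchSum hm k)
      (memLp_one_iff_integrable.1 (memLp_iterate_branchSum hq hm
        (memLp_one_iff_integrable.2 hf) k)), ih]
    ring

lemma integral_iterate_branchSum_sq (hq : ∀ k, B < k → q k = 0) {f : (List ℕ → ℕ) → ℝ}
    (hm : Measurable f) (hf : MemLp f 2 (galtonWatsonMeasure q))
    (h0 : ∫ N, f N ∂galtonWatsonMeasure q = 0) (k : ℕ) :
    ∫ N, branchSum^[k] f N ^ 2 ∂galtonWatsonMeasure q =
      mean q ^ k * ∫ N, f N ^ 2 ∂galtonWatsonMeasure q := by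
  induction k with
  | zero => simp
  | succ k ih =>
    rw [Function.iterate_succ_apply', integral_branchSum_sq hq
      (measurable_iterate_branchSum hm k) (memLp_iterate_branchSum hq hm hf k)
      (by rw [integral_iterate_branchSum hq hm (hf.integrable (by norm_num)), h0, mul_zero]), ih]
    ring

lemma iterate_branchSum_linear (f g : (List ℕ → ℕ) → ℝ) (a c : ℝ) (k : ℕ) (N : List ℕ → ℕ) :
    branchSum^[k] (fun N => a * f N + c * g N) N =
      a * branchSum^[k] f N + c * branchSum^[k] g N := by
  induction k generalizing N with
  | zero => simp
  | succ k ih =>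
    simp only [Function.iterate_succ_apply']
    simp only [branchSum, ih, Finset.sum_add_distrib, Finset.mul_sum]

/-- Normalized sums of a centred functional over the generations are absolutely summable in
`L¹`: they decay geometrically in `L²`. -/
lemma summable_integral_iterate_branchSum (hq : ∀ k, B < k → q k = 0) (hmean : 1 < mean q)
    {f : (List ℕ → ℕ) → ℝ} (hm : Measurable f) (hf : MemLp f 2 (galtonWatsonMeasure q))
    (h0 : ∫ N, f N ∂galtonWatsonMeasure q = 0) :
    Summable fun k => ∫ N, ‖(mean q ^ k)⁻¹ * branchSum^[k] f N‖ ∂galtonWatsonMeasure q := by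
  -- `s` is the geometric rate of the `L²` norms; `|x| ≤ sᵏ + x² / sᵏ` passes from `L²` to `L¹`.
  set s : ℝ := (√(mean q))⁻¹ with hs
  have hs0 : 0 < s := by positivity
  have hs1 : s < 1 := inv_lt_one_of_one_lt₀ (by rw [Real.lt_sqrt (by norm_num)]; simpa using hmean)
  have hs2 : s ^ 2 = (mean q)⁻¹ := by rw [hs, inv_pow, Real.sq_sqrt (by linarith)]
  refine Summable.of_nonneg_of_le (fun k => integral_nonneg fun _ => norm_nonneg _) (fun k => ?_)
    ((summable_geometric_of_lt_one hs0.le hs1).mul_left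
      (1 + ∫ N, f N ^ 2 ∂galtonWatsonMeasure q))
  have hL : MemLp (fun N => (mean q ^ k)⁻¹ * branchSum^[k] f N) 2 (galtonWatsonMeasure q) :=
    (memLp_iterate_branchSum hq hm hf k).const_mul _
  have hsq : ∫ N, ((mean q ^ k)⁻¹ * branchSum^[k] f N) ^ 2 ∂galtonWatsonMeasure q =
      s ^ k * s ^ k * ∫ N, f N ^ 2 ∂galtonWatsonMeasure q := by
    simp only [mul_pow]
    rw [integral_const_mul, integral_iterate_branchSum_sq hq hm hf h0, ← mul_pow, ← sq s, hs2]
    have : mean q ^ k ≠ 0 := by positivity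
    simp only [inv_pow]
    field_simp
  calc ∫ N, ‖(mean q ^ k)⁻¹ * branchSum^[k] f N‖ ∂galtonWatsonMeasure q
      ≤ ∫ N, (s ^ k + (s ^ k)⁻¹ * ((mean q ^ k)⁻¹ * branchSum^[k] f N) ^ 2)
          ∂galtonWatsonMeasure q := by
        refine integral_mono (hL.integrable (by norm_num)).norm
          ((integrable_const _).add (hL.integrable_sq.const_mul _)) fun N => ?_
        set x := (mean q ^ k)⁻¹ * branchSum^[k] f N
        have hp : 0 < s ^ k := by positivity
        change |x| ≤ s ^ k + (s ^ k)⁻¹ * x ^ 2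
        rw [← sq_abs x]
        have h2 : s ^ k + (s ^ k)⁻¹ * |x| ^ 2 - |x| =
            (s ^ k)⁻¹ * ((s ^ k - |x| / 2) ^ 2 + 3 / 4 * |x| ^ 2) := by
          field_simp; ring
        have : 0 ≤ (s ^ k)⁻¹ * ((s ^ k - |x| / 2) ^ 2 + 3 / 4 * |x| ^ 2) := by positivity
        linarith
    _ = (1 + ∫ N, f N ^ 2 ∂galtonWatsonMeasure q) * s ^ k := by
        rw [integral_add (integrable_const _) (hL.integrable_sq.const_mul _),
          integral_const_mul, hsq]
        have : s ^ k ≠ 0 := by positivity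
        simp
        field_simp

lemma ae_summable_iterate_branchSum (hq : ∀ k, B < k → q k = 0) (hmean : 1 < mean q)
    {f : (List ℕ → ℕ) → ℝ} (hm : Measurable f) (hf : MemLp f 2 (galtonWatsonMeasure q))
    (h0 : ∫ N, f N ∂galtonWatsonMeasure q = 0) :
    ∀ᵐ N ∂galtonWatsonMeasure q, Summable fun k => (mean q ^ k)⁻¹ * branchSum^[k] f N := by
  have hint : ∀ k, Integrable (fun N => (mean q ^ k)⁻¹ * branchSum^[k] f N)
      (galtonWatsonMeasure q) := fun k =>
    ((memLp_iterate_branchSum hq hm hf k).integrable (by norm_num)).const_mul _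
  have h := summable_norm_of_tsum_eLpNorm_ne_top (μ := galtonWatsonMeasure q) le_rfl
    (fun k => (hint k).1) (f := fun k N => (mean q ^ k)⁻¹ * branchSum^[k] f N) ?_
  · filter_upwards [h] with N hN using hN.of_norm
  · have he : ∀ k, eLpNorm (fun N => (mean q ^ k)⁻¹ * branchSum^[k] f N) 1
        (galtonWatsonMeasure q) = ENNReal.ofReal
          (∫ N, ‖(mean q ^ k)⁻¹ * branchSum^[k] f N‖ ∂galtonWatsonMeasure q) := fun k => by
      rw [eLpNorm_one_eq_lintegral_enorm, ofReal_integral_norm_eq_lintegral_enorm (hint k)]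
    simp_rw [he]
    exact (summable_integral_iterate_branchSum hq hmean hm hf h0).tsum_ofReal_ne_top

/-- The size of generation `n`. -/
noncomputable def population (n : ℕ) : (List ℕ → ℕ) → ℝ := branchSum^[n] fun _ => 1

lemma population_succ (n : ℕ) : population (n + 1) = branchSum (population n) :=
  Function.iterate_succ_apply' _ _ _

lemma population_succ' (n : ℕ) : population (n + 1) = branchSum^[n] fun N => (N [] : ℝ) := by
  rw [population, Function.iterate_succ_apply]
  congr 1
  ext N
  simp [branchSum]

lemma population_nonneg (n : ℕ) (N : List ℕ → ℕ) : 0 ≤ population n N := by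
  induction n generalizing N with
  | zero => simp [population]
  | succ n ih => rw [population_succ]; exact Finset.sum_nonneg fun i _ => ih _

lemma measurable_population (n : ℕ) : Measurable (population n) :=
  measurable_iterate_branchSum measurable_const n

/-- The normalized, centred number of children of the root. -/
noncomputable def centredOffspring (q : PMF ℕ) (N : List ℕ → ℕ) : ℝ := (mean q)⁻¹ * N [] - 1

lemma measurable_centredOffspring : Measurable (centredOffspring q) := by
  have : Measurable fun k : ℕ => (mean q)⁻¹ * (k : ℝ) - 1 := measurable_of_countable _
  exact this.comp (measurable_pi_apply [])

lemma memLp_centredOffspring (hq : ∀ k, B < k → q k = 0) (p : ℝ≥0∞) :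
    MemLp (centredOffspring q) p (galtonWatsonMeasure q) := by
  refine MemLp.of_bound measurable_centredOffspring.aestronglyMeasurable
    (|(mean q)⁻¹| * B + 1) ?_
  filter_upwards [ae_offspring_le hq []] with N hN
  have : (N [] : ℝ) ≤ B := by exact_mod_cast hN
  calc ‖centredOffspring q N‖ ≤ ‖(mean q)⁻¹ * N []‖ + ‖(1 : ℝ)‖ := norm_sub_le _ _
    _ ≤ _ := by
      rw [norm_mul, Real.norm_eq_abs]; simp; gcongr

lemma integral_centredOffspring (hq : ∀ k, B < k → q k = 0) (hmean : 1 < mean q) :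
    ∫ N, centredOffspring q N ∂galtonWatsonMeasure q = 0 := by
  have hmp := map_eval_galtonWatsonMeasure q []
  have hi : Integrable (fun k : ℕ => (k : ℝ)) q.toMeasure := by
    simpa using integrable_offspring hq 1
  have h1 : Integrable (fun N : List ℕ → ℕ => (N [] : ℝ)) (galtonWatsonMeasure q) :=
    hmp.integrable_comp_of_integrable hi
  have h2 : ∫ N, (N [] : ℝ) ∂galtonWatsonMeasure q = mean q := by
    rw [← integral_offspring hq, ← hmp.map_eq,
      integral_map hmp.measurable.aemeasurable (by rw [hmp.map_eq]; exact hi.1)]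
  unfold centredOffspring
  rw [integral_sub (h1.const_mul _) (integrable_const _), integral_const_mul, h2]
  have : mean q ≠ 0 := by positivity
  simp [this]

lemma normalized_iterate_centredOffspring (hmean : 1 < mean q) (n : ℕ) (N : List ℕ → ℕ) :
    (mean q ^ n)⁻¹ * branchSum^[n] (centredOffspring q) N =
      population (n + 1) N / mean q ^ (n + 1) - population n N / mean q ^ n := by
  have h : centredOffspring q = fun N => (mean q)⁻¹ * (fun N : List ℕ → ℕ => (N [] : ℝ)) N +
      (-1) * (fun _ => (1 : ℝ)) N := by
    ext N; simp [centredOffspring]; ring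
  rw [h, iterate_branchSum_linear, ← population_succ', ← population]
  have : mean q ≠ 0 := by positivity
  field_simp
  ring

/-- The limit `W` of the population martingale `Zₙ / mⁿ`. -/
noncomputable def martingaleLimit (q : PMF ℕ) (N : List ℕ → ℕ) : ℝ :=
  1 + ∑' n : ℕ, (mean q ^ n)⁻¹ * branchSum^[n] (centredOffspring q) N

lemma measurable_martingaleLimit : Measurable (martingaleLimit q) := by
  refine measurable_const.add (Measurable.tsum fun n => ?_)
  exact (measurable_iterate_branchSum measurable_centredOffspring n).const_mul _

lemma not_ae_martingaleLimit_eq_zero (hq : ∀ k, B < k → q k = 0) (hmean : 1 < mean q) :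
    ¬ ∀ᵐ N ∂galtonWatsonMeasure q, martingaleLimit q N = 0 := by
  intro hae
  have hL := memLp_centredOffspring hq 2
  have hint : ∀ k, Integrable (fun N => (mean q ^ k)⁻¹ * branchSum^[k] (centredOffspring q) N)
      (galtonWatsonMeasure q) := fun k =>
    ((memLp_iterate_branchSum hq measurable_centredOffspring hL k).integrable
      (by norm_num)).const_mul _
  have h := hasSum_integral_of_summable_integral_norm hint
    (summable_integral_iterate_branchSum hq hmean measurable_centredOffspring hL
      (integral_centredOffspring hq hmean))
  have hz : ∀ k, ∫ N, (mean q ^ k)⁻¹ * branchSum^[k] (centredOffspring q) N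
      ∂galtonWatsonMeasure q = 0 := fun k => by
    rw [integral_const_mul, integral_iterate_branchSum hq measurable_centredOffspring
      (hL.integrable (by norm_num)), integral_centredOffspring hq hmean]
    simp
  simp_rw [hz] at h
  have h0 : ∫ N, ∑' k : ℕ, (mean q ^ k)⁻¹ * branchSum^[k] (centredOffspring q) N
      ∂galtonWatsonMeasure q = 0 := h.unique hasSum_zero
  have h1 : ∫ N, ∑' k : ℕ, (mean q ^ k)⁻¹ * branchSum^[k] (centredOffspring q) N
      ∂galtonWatsonMeasure q = ∫ N, (-1 : ℝ) ∂galtonWatsonMeasure q := by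
    refine integral_congr_ae ?_
    filter_upwards [hae] with N hN
    unfold martingaleLimit at hN
    linarith
  rw [h0] at h1
  simp at h1

lemma ae_tendsto_population (hq : ∀ k, B < k → q k = 0) (hmean : 1 < mean q) :
    ∀ᵐ N ∂galtonWatsonMeasure q,
      Tendsto (fun n => population n N / mean q ^ n) atTop (𝓝 (martingaleLimit q N)) := by
  filter_upwards [ae_summable_iterate_branchSum hq hmean measurable_centredOffspring
    (memLp_centredOffspring hq 2) (integral_centredOffspring hq hmean)] with N hN
  have h := hN.hasSum.tendsto_sum_nat.const_add 1
  refine h.congr fun n => ?_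
  simp_rw [normalized_iterate_centredOffspring hmean]
  rw [Finset.sum_range_sub (fun n => population n N / mean q ^ n)]
  simp [population]

/-! ### Positivity of the limit -/

lemma ae_martingaleLimit_recursion (hq : ∀ k, B < k → q k = 0) (hmean : 1 < mean q) :
    ∀ᵐ N ∂galtonWatsonMeasure q, mean q * martingaleLimit q N =
      ∑ i ∈ range (N []), martingaleLimit q (subtree [i] N) := by
  have h := ae_tendsto_population hq hmean
  have h' : ∀ᵐ N ∂galtonWatsonMeasure q, ∀ i : ℕ,
      Tendsto (fun n => population n (subtree [i] N) / mean q ^ n) atTop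
        (𝓝 (martingaleLimit q (subtree [i] N))) :=
    ae_all_iff.2 fun i => (measurePreserving_subtree q [i]).quasiMeasurePreserving.ae h
  filter_upwards [h, h'] with N hN hN'
  have h1 := ((tendsto_add_atTop_iff_nat 1).2 hN).const_mul (mean q)
  have h2 := tendsto_finsetSum (range (N [])) fun i _ => hN' i
  refine tendsto_nhds_unique h1 (h2.congr fun n => ?_)
  rw [population_succ]
  have : mean q ≠ 0 := by positivity
  simp only [branchSum, Finset.sum_div]
  rw [Finset.mul_sum]
  refine Finset.sum_congr rfl fun i _ => ?_
  rw [pow_succ]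
  field_simp

lemma ae_martingaleLimit_nonneg (hq : ∀ k, B < k → q k = 0) (hmean : 1 < mean q) :
    ∀ᵐ N ∂galtonWatsonMeasure q, 0 ≤ martingaleLimit q N := by
  filter_upwards [ae_tendsto_population hq hmean] with N hN
  exact ge_of_tendsto' hN fun n => div_nonneg (population_nonneg n N) (by positivity)

lemma not_ae_offspring_eq_one (hq1 : q 1 ≠ 1) : ¬ ∀ᵐ k ∂q.toMeasure, k = 1 := by
  intro h
  have h1 : q.toMeasure {1} = 1 := by
    rw [prob_compl_eq_zero_iff (measurableSet_singleton 1) |>.symm]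
    exact h
  rw [PMF.toMeasure_apply_singleton _ _ (measurableSet_singleton _)] at h1
  exact hq1 h1

lemma ae_one_le_offspring (hq0 : q 0 = 0) : ∀ᵐ k ∂q.toMeasure, 1 ≤ k := by
  have : {k | ¬ 1 ≤ k} = {0} := by ext; simp
  rw [ae_iff, this, PMF.toMeasure_apply_singleton _ _ (measurableSet_singleton _), hq0]

lemma one_lt_mean (hq : ∀ k, B < k → q k = 0) (hq0 : q 0 = 0) (hq1 : q 1 ≠ 1) :
    1 < mean q := by
  have hi : Integrable (fun k : ℕ => (k : ℝ)) q.toMeasure := by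
    simpa using integrable_offspring hq 1
  have hi' : Integrable (fun k : ℕ => (k : ℝ) - 1) q.toMeasure := hi.sub (integrable_const _)
  have h0 : 0 ≤ᵐ[q.toMeasure] fun k : ℕ => (k : ℝ) - 1 := by
    filter_upwards [ae_one_le_offspring hq0] with k hk
    have : (1 : ℝ) ≤ k := by exact_mod_cast hk
    simpa using this
  have h1 : ∫ k : ℕ, ((k : ℝ) - 1) ∂q.toMeasure = mean q - 1 := by
    rw [integral_sub hi (integrable_const _), integral_offspring hq]; simp
  have h2 := integral_nonneg_of_ae h0
  have h3 : ∫ k : ℕ, ((k : ℝ) - 1) ∂q.toMeasure ≠ 0 := by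
    rw [Ne, integral_eq_zero_iff_of_nonneg_ae h0 hi']
    intro h
    refine not_ae_offspring_eq_one hq1 ?_
    filter_upwards [h] with k hk
    have : (k : ℝ) = 1 := by simpa [sub_eq_zero] using hk
    exact_mod_cast this
  have := lt_of_le_of_ne h2 (Ne.symm h3)
  linarith

/-- The limit is almost surely positive: `p = ℙ(W = 0) < 1` is a fixed point of the offspring
generating function, which has none in `(0, 1)` when there are no deaths. -/
lemma ae_martingaleLimit_pos (hq : ∀ k, B < k → q k = 0) (hq0 : q 0 = 0) (hq1 : q 1 ≠ 1) :
    ∀ᵐ N ∂galtonWatsonMeasure q, 0 < martingaleLimit q N := by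
  have hmean := one_lt_mean hq hq0 hq1
  set A : Set (List ℕ → ℕ) := {N | martingaleLimit q N = 0} with hA
  have hAm : MeasurableSet A := measurable_martingaleLimit (measurableSet_singleton 0)
  have hfix : galtonWatsonMeasure q A =
      ∫⁻ k, (galtonWatsonMeasure q A) ^ k ∂q.toMeasure := by
    have h := lintegral_prod_subtree q (F := A.indicator 1) (measurable_one.indicator hAm)
    rw [lintegral_indicator_one hAm] at h
    rw [← h, ← lintegral_indicator_one hAm]
    refine lintegral_congr_ae ?_
    have hnn : ∀ᵐ N ∂galtonWatsonMeasure q, ∀ i : ℕ, 0 ≤ martingaleLimit q (subtree [i] N) :=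
      ae_all_iff.2 fun i => (measurePreserving_subtree q [i]).quasiMeasurePreserving.ae
        (ae_martingaleLimit_nonneg hq hmean)
    filter_upwards [hnn, ae_martingaleLimit_recursion hq hmean] with N h1 h2
    have h3 : N ∈ A ↔ ∀ i ∈ range (N []), subtree [i] N ∈ A := by
      have : mean q ≠ 0 := by positivity
      calc N ∈ A ↔ mean q * martingaleLimit q N = 0 := by simp [hA, this]
        _ ↔ _ := by
          rw [h2, Finset.sum_eq_zero_iff_of_nonneg fun i _ => h1 i]
          rfl
    simp only [Set.indicator_apply, Pi.one_apply]
    rw [Finset.prod_ite_zero]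
    simp [h3]
  set p := galtonWatsonMeasure q A with hp
  have hp1 : p ≠ 1 := fun h => by
    refine not_ae_martingaleLimit_eq_zero hq hmean ?_
    exact (prob_compl_eq_zero_iff hAm).2 h
  have hple : p ≤ 1 := prob_le_one
  have hplt : p < 1 := lt_of_le_of_ne hple hp1
  have hp0 : p = 0 := by
    by_contra hne
    have hae : (fun k : ℕ => p ^ k) =ᵐ[q.toMeasure] fun _ => p := by
      refine ae_eq_of_ae_le_of_lintegral_le ?_ ?_ aemeasurable_const ?_
      · filter_upwards [ae_one_le_offspring hq0] with k hk
        exact pow_le_of_le_one (by simp) hple (by omega)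
      · rw [← hfix]; exact hplt.ne_top
      · rw [← hfix]; simp
    refine not_ae_offspring_eq_one hq1 ?_
    filter_upwards [hae] with k hk
    have hk' : p ^ k = p ^ 1 := by simpa using hk
    by_contra hk1
    have := congrArg ENNReal.toReal hk'
    rw [ENNReal.toReal_pow, ENNReal.toReal_pow] at this
    have hlt : p.toReal < 1 := by
      rw [← ENNReal.toReal_one]; exact (ENNReal.toReal_lt_toReal hplt.ne_top (by simp)).2 hplt
    have hpos : 0 < p.toReal := ENNReal.toReal_pos hne hplt.ne_top
    exact hk1 (pow_right_injective₀ hpos hlt.ne this)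
  have : ∀ᵐ N ∂galtonWatsonMeasure q, N ∉ A := measure_eq_zero_iff_ae_notMem.1 hp0
  filter_upwards [this, ae_martingaleLimit_nonneg hq hmean] with N h1 h2
  exact lt_of_le_of_ne h2 fun h => h1 h.symm

end iterate

/-! ### Exponential moments and sums of squares over a generation -/

section moments

variable {q : PMF ℕ} {B : ℕ}

lemma lintegral_exp_offspring_le (hq : ∀ k, B < k → q k = 0) {s : ℝ} (hs : 0 ≤ s)
    (hsB : s * B ≤ 1) :
    ∫⁻ k : ℕ, ENNReal.ofReal (Real.exp s) ^ k ∂q.toMeasure ≤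
      ENNReal.ofReal (Real.exp (s * mean q + s ^ 2 * B ^ 2)) := by
  have hi : Integrable (fun k : ℕ => (k : ℝ)) q.toMeasure := by
    simpa using integrable_offspring hq 1
  have hle : ∫⁻ k : ℕ, ENNReal.ofReal (Real.exp s) ^ k ∂q.toMeasure ≤
      ∫⁻ k : ℕ, ENNReal.ofReal (1 + s * k + s ^ 2 * B ^ 2) ∂q.toMeasure := by
    refine lintegral_mono_ae ?_
    filter_upwards [ae_le_offspring hq] with k hk
    have hk' : (k : ℝ) ≤ B := by exact_mod_cast hk
    rw [← ENNReal.ofReal_pow (Real.exp_pos _).le, ← Real.exp_nat_mul]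
    refine ENNReal.ofReal_le_ofReal ?_
    have h0 : 0 ≤ k * s := by positivity
    have h1 : k * s ≤ B * s := by gcongr
    have h2 := (abs_le.1 (Real.abs_exp_sub_one_sub_id_le (x := k * s)
      (by rw [abs_of_nonneg h0]; linarith))).2
    have h3 : (k * s) ^ 2 ≤ (B * s) ^ 2 := by gcongr
    nlinarith
  refine hle.trans ?_
  rw [← ofReal_integral_eq_lintegral_ofReal]
  · refine ENNReal.ofReal_le_ofReal ?_
    have : ∫ k : ℕ, (1 + s * (k : ℝ) + s ^ 2 * B ^ 2) ∂q.toMeasure =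
        s * mean q + s ^ 2 * B ^ 2 + 1 := by
      have hi1 : Integrable (fun k : ℕ => 1 + s * (k : ℝ)) q.toMeasure :=
        (integrable_const _).add (hi.const_mul _)
      rw [integral_add hi1 (integrable_const _), integral_add (integrable_const _) (hi.const_mul _),
        integral_const_mul, integral_offspring hq]
      simp; ring
    rw [this]
    exact Real.add_one_le_exp _
  · exact ((integrable_const _).add (hi.const_mul _)).add (integrable_const _)
  · exact Eventually.of_forall fun k => by simp only [Pi.zero_apply]; positivity

/-- Exponential moments of the normalized population sizes are bounded uniformly in the
generation. -/
lemma exists_exponential_moment (hq : ∀ k, B < k → q k = 0) (hmean : 1 < mean q) :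
    ∃ t K : ℝ, 0 < t ∧ ∀ n, ∫⁻ N, ENNReal.ofReal (Real.exp (t * (population n N / mean q ^ n)))
      ∂galtonWatsonMeasure q ≤ ENNReal.ofReal K := by
  set m := mean q with hm
  have hm0 : 0 < m := by linarith
  have hm1 : 0 < m - 1 := by linarith
  -- `K` is chosen so that `t + K t²` is preserved by one step of the branching recursion.
  set K : ℝ := 4 * B ^ 2 / (m * (m - 1)) with hK
  have hK0 : 0 ≤ K := by positivity
  have hKeq : K * m * (m - 1) = 4 * B ^ 2 := by rw [hK]; field_simp
  set t₀ : ℝ := 1 / (2 * B + K + 1) with ht₀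
  have hden : 0 < 2 * (B : ℝ) + K + 1 := by positivity
  have ht₀0 : 0 < t₀ := by positivity
  have ht₀1 : t₀ * (2 * B + K + 1) = 1 := by rw [ht₀]; field_simp
  have key : ∀ n (t : ℝ), 0 ≤ t → t ≤ t₀ →
      ∫⁻ N, ENNReal.ofReal (Real.exp (t * (population n N / m ^ n))) ∂galtonWatsonMeasure q ≤
        ENNReal.ofReal (Real.exp (t + K * t ^ 2)) := by
    intro n
    induction n with
    | zero =>
      intro t ht _
      simp only [population, Function.iterate_zero, id, pow_zero, div_one, mul_one,
        lintegral_const, measure_univ]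
      refine ENNReal.ofReal_le_ofReal (Real.exp_le_exp.2 ?_)
      nlinarith [sq_nonneg t]
    | succ n ih =>
      intro t ht htt
      have hb : t * (2 * B + K + 1) ≤ 1 :=
        (mul_le_mul_of_nonneg_right htt hden.le).trans ht₀1.le
      have hB0 : (0 : ℝ) ≤ t * B := by positivity
      have hKt0 : 0 ≤ t * K := by positivity
      have hKt : K * t ≤ 1 := by nlinarith
      have hBt : 2 * (t * B) ≤ 1 := by nlinarith
      set s : ℝ := t / m + K * (t / m) ^ 2 with hs
      have hs0 : 0 ≤ s := by positivity
      have htm : 0 ≤ t / m := by positivity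
      have htm' : t / m ≤ t := div_le_self ht hmean.le
      have hs2 : s ≤ 2 * (t / m) := by
        have : K * (t / m) ≤ 1 := le_trans (by gcongr) hKt
        rw [hs]; nlinarith
      have hrec : ∀ N, ENNReal.ofReal (Real.exp (t * (population (n + 1) N / m ^ (n + 1)))) =
          ∏ i ∈ range (N []), ENNReal.ofReal
            (Real.exp (t / m * (population n (subtree [i] N) / m ^ n))) := fun N => by
        rw [← ENNReal.ofReal_prod_of_nonneg fun _ _ => (Real.exp_pos _).le, ← Real.exp_sum,
          population_succ, branchSum]
        congr 2
        rw [Finset.sum_div, Finset.mul_sum]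
        refine Finset.sum_congr rfl fun i _ => ?_
        rw [pow_succ]
        field_simp
      simp_rw [hrec]
      have hmeas : Measurable fun N : List ℕ → ℕ =>
          ENNReal.ofReal (Real.exp (t / m * (population n N / m ^ n))) := by
        have := measurable_population n
        fun_prop
      rw [lintegral_prod_subtree q hmeas]
      calc ∫⁻ k, (∫⁻ N, ENNReal.ofReal (Real.exp (t / m * (population n N / m ^ n)))
              ∂galtonWatsonMeasure q) ^ k ∂q.toMeasure
          ≤ ∫⁻ k, ENNReal.ofReal (Real.exp s) ^ k ∂q.toMeasure := by
            refine lintegral_mono fun k => ?_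
            gcongr
            exact ih (t / m) htm (htm'.trans htt)
        _ ≤ ENNReal.ofReal (Real.exp (s * m + s ^ 2 * B ^ 2)) := by
            refine lintegral_exp_offspring_le hq hs0 ?_
            calc s * B ≤ 2 * (t / m) * B := by gcongr
              _ ≤ 2 * t * B := by gcongr
              _ ≤ 1 := by linarith
        _ ≤ ENNReal.ofReal (Real.exp (t + K * t ^ 2)) := by
            refine ENNReal.ofReal_le_ofReal (Real.exp_le_exp.2 ?_)
            have h1 : s ^ 2 ≤ (2 * (t / m)) ^ 2 := by gcongr
            have h2 : s ^ 2 * B ^ 2 ≤ (2 * (t / m)) ^ 2 * B ^ 2 := by gcongr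
            have h3 : s * m = t + K * t ^ 2 / m := by rw [hs]; field_simp
            have h4 : (2 * (t / m)) ^ 2 * B ^ 2 = K * t ^ 2 * (m - 1) / m := by
              have : (2 * (t / m)) ^ 2 * (B : ℝ) ^ 2 = (4 * B ^ 2) * t ^ 2 / m ^ 2 := by
                field_simp; ring
              rw [this, ← hKeq]; field_simp
            have h5 : K * t ^ 2 / m + K * t ^ 2 * (m - 1) / m = K * t ^ 2 := by
              field_simp; ring
            linarith
  exact ⟨t₀, _, ht₀0, fun n => key n t₀ ht₀0.le le_rfl⟩

lemma integrable_martingaleLimit_pow_four (hq : ∀ k, B < k → q k = 0) (hmean : 1 < mean q) :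
    Integrable (fun N => martingaleLimit q N ^ 4) (galtonWatsonMeasure q) := by
  obtain ⟨t, K, ht, hK⟩ := exists_exponential_moment hq hmean
  have hbound : ∀ n, ∫⁻ N, ENNReal.ofReal ((population n N / mean q ^ n) ^ 4)
      ∂galtonWatsonMeasure q ≤ ENNReal.ofReal (24 / t ^ 4) * ENNReal.ofReal K := fun n => by
    refine le_trans ?_ (mul_le_mul_right (hK n) _)
    rw [← lintegral_const_mul' _ _ ENNReal.ofReal_ne_top]
    refine lintegral_mono fun N => ?_
    rw [← ENNReal.ofReal_mul (by positivity)]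
    refine ENNReal.ofReal_le_ofReal ?_
    have hx : 0 ≤ population n N / mean q ^ n := div_nonneg (population_nonneg n N) (by positivity)
    have := Real.pow_div_factorial_le_exp (x := t * (population n N / mean q ^ n))
      (by positivity) 4
    rw [mul_pow, div_le_iff₀ (by positivity)] at this
    rw [div_mul_eq_mul_div, le_div_iff₀ (by positivity)]
    norm_num [Nat.factorial] at this
    linarith
  have hm := measurable_martingaleLimit (q := q)
  refine ⟨(hm.pow_const 4).aestronglyMeasurable, ?_⟩
  rw [hasFiniteIntegral_iff_ofReal (Eventually.of_forall fun N => by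
    simp only [Pi.zero_apply]; positivity)]
  have hlim : ∫⁻ N, ENNReal.ofReal (martingaleLimit q N ^ 4) ∂galtonWatsonMeasure q =
      ∫⁻ N, liminf (fun n => ENNReal.ofReal ((population n N / mean q ^ n) ^ 4)) atTop
        ∂galtonWatsonMeasure q := by
    refine lintegral_congr_ae ?_
    filter_upwards [ae_tendsto_population hq hmean] with N hN
    exact ((ENNReal.tendsto_ofReal (hN.pow 4)).liminf_eq).symm
  rw [hlim]
  refine lt_of_le_of_lt (lintegral_liminf_le fun n => ?_) ?_
  · have := measurable_population n
    fun_prop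
  · refine lt_of_le_of_lt (b := ENNReal.ofReal (24 / t ^ 4) * ENNReal.ofReal K)
      (liminf_le_of_le (by isBoundedDefault) fun b hb => ?_)
      (ENNReal.mul_lt_top ENNReal.ofReal_lt_top ENNReal.ofReal_lt_top)
    obtain ⟨n, hn⟩ := hb.exists
    exact hn.trans (hbound n)

/-- The sum of `W²` over generation `k` is almost surely at most a constant times `mᵏ`. -/
lemma ae_exists_sum_sq_le (hq : ∀ k, B < k → q k = 0) (hmean : 1 < mean q) :
    ∀ᵐ N ∂galtonWatsonMeasure q, ∃ C : ℝ, ∀ k,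
      branchSum^[k] (fun N => martingaleLimit q N ^ 2) N ≤ C * mean q ^ k ∧
        population k N ≤ C * mean q ^ k := by
  have hW := measurable_martingaleLimit (q := q)
  have hL : MemLp (fun N => martingaleLimit q N ^ 2) 2 (galtonWatsonMeasure q) := by
    rw [memLp_two_iff_integrable_sq (hW.pow_const 2).aestronglyMeasurable]
    simpa only [← pow_mul] using integrable_martingaleLimit_pow_four hq hmean
  set c : ℝ := ∫ N, martingaleLimit q N ^ 2 ∂galtonWatsonMeasure q with hc
  have hc0 : 0 ≤ c := integral_nonneg fun N => sq_nonneg _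
  -- `f` is `W² - 𝔼 W²`, written as a linear combination.
  set f : (List ℕ → ℕ) → ℝ := fun N => 1 * martingaleLimit q N ^ 2 + (-c) * 1 with hf
  have hfm : Measurable f := by
    have : Measurable fun N => 1 * martingaleLimit q N ^ 2 + (-c) * 1 := by fun_prop
    exact this
  have hfL : MemLp f 2 (galtonWatsonMeasure q) :=
    (hL.const_mul 1).add (memLp_const _)
  have hf0 : ∫ N, f N ∂galtonWatsonMeasure q = 0 := by
    rw [hf, integral_add ((hL.integrable (by norm_num)).const_mul 1) (integrable_const _)]
    simp [← hc]
  filter_upwards [ae_summable_iterate_branchSum hq hmean hfm hfL hf0,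
    ae_tendsto_population hq hmean] with N h1 h2
  obtain ⟨a, ha⟩ := h1.tendsto_atTop_zero.bddAbove_range
  obtain ⟨b, hb⟩ := h2.bddAbove_range
  have hb0 : 0 ≤ b := le_trans (by simp [population]) (hb ⟨0, rfl⟩)
  refine ⟨max b (a + c * b), fun k => ?_⟩
  have hmk : 0 < mean q ^ k := by positivity
  have hpk : population k N ≤ b * mean q ^ k := by
    rw [← div_le_iff₀ hmk]; exact hb ⟨k, rfl⟩
  constructor
  · have hlin := iterate_branchSum_linear (fun N => martingaleLimit q N ^ 2) (fun _ => 1) 1 (-c) k N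
    have hak : branchSum^[k] f N ≤ a * mean q ^ k := by
      have : (mean q ^ k)⁻¹ * branchSum^[k] f N ≤ a := ha ⟨k, rfl⟩
      rwa [inv_mul_le_iff₀ hmk, mul_comm] at this
    rw [hf, hlin] at hak
    change 1 * _ + (-c) * population k N ≤ _ at hak
    calc branchSum^[k] (fun N => martingaleLimit q N ^ 2) N
        ≤ a * mean q ^ k + c * population k N := by linarith
      _ ≤ a * mean q ^ k + c * (b * mean q ^ k) := by gcongr
      _ = (a + c * b) * mean q ^ k := by ring
      _ ≤ _ := by gcongr; exact le_max_right _ _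
  · exact hpk.trans (by gcongr; exact le_max_left _ _)

end moments

/-! ### The generations of the family tree -/

/-- The set of vertices of generation `n`. -/
def level : ℕ → (List ℕ → ℕ) → Finset (List ℕ)
  | 0, _ => {[]}
  | n + 1, N => (range (N [])).biUnion fun i => (level n (subtree [i] N)).image (i :: ·)

lemma cons_mem_familyTree {N : List ℕ → ℕ} {i : ℕ} {v : List ℕ} :
    i :: v ∈ familyTree N ↔ i < N [] ∧ v ∈ familyTree (subtree [i] N) := by
  simp only [familyTree, Set.mem_ofPred_eq, subtree]
  constructor
  · intro h
    exact ⟨h [] i (by simp), fun u j huj => h (i :: u) j (by simpa using huj)⟩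
  · rintro ⟨h1, h2⟩ u j huj
    cases u with
    | nil =>
      have : j = i := by simpa using huj
      rwa [this]
    | cons k u =>
      simp only [List.cons_append, List.cons_prefix_cons] at huj
      obtain ⟨rfl, huj⟩ := huj
      exact h2 u j huj

lemma nil_mem_familyTree (N : List ℕ → ℕ) : [] ∈ familyTree N := by
  intro u i h
  simp at h

lemma mem_level {n : ℕ} {N : List ℕ → ℕ} {v : List ℕ} :
    v ∈ level n N ↔ v ∈ familyTree N ∧ v.length = n := by
  induction n generalizing N v with
  | zero =>
    simp only [level, Finset.mem_singleton, List.length_eq_zero_iff]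
    exact ⟨fun h => ⟨h ▸ nil_mem_familyTree N, h⟩, fun h => h.2⟩
  | succ n ih =>
    cases v with
    | nil => simp [level]
    | cons i v => simp [level, ih, cons_mem_familyTree, and_assoc]

lemma iterate_branchSum_eq_sum_level (f : (List ℕ → ℕ) → ℝ) (n : ℕ) (N : List ℕ → ℕ) :
    branchSum^[n] f N = ∑ v ∈ level n N, f (subtree v N) := by
  induction n generalizing N with
  | zero => simp [level, subtree_nil]
  | succ n ih =>
    rw [Function.iterate_succ_apply', branchSum, level, Finset.sum_biUnion]
    · refine Finset.sum_congr rfl fun i _ => ?_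
      rw [ih, Finset.sum_image (by intro a _ b _ h; simpa using h)]
      refine Finset.sum_congr rfl fun v _ => ?_
      rw [← subtree_append]; rfl
    · intro i _ j _ hij
      rw [Function.onFun, Finset.disjoint_left]
      intro v hv hv'
      simp only [Finset.mem_image] at hv hv'
      obtain ⟨a, _, rfl⟩ := hv
      obtain ⟨c, _, h⟩ := hv'
      simp only [List.cons.injEq] at h
      exact hij h.1.symm

lemma population_eq_card_level (n : ℕ) (N : List ℕ → ℕ) : population n N = #(level n N) := by
  rw [population, iterate_branchSum_eq_sum_level]; simp

/-- Everything that is needed of a typical Galton-Watson tree: a positive harmonic weight `w`, given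
on all words, whether in the tree or not, whose squares sum to `O(mᵏ)` over generation `k`, and
generations of size `O(mᵏ)`. -/
structure IsTypical (m : ℝ) (N : List ℕ → ℕ) (w : List ℕ → ℝ) (C : ℝ) : Prop where
  pos : ∀ u, 0 < w u
  harmonic : ∀ u, m * w u = ∑ i ∈ range (N u), w (u ++ [i])
  sum_sq_le : ∀ k, ∑ u ∈ level k N, w u ^ 2 ≤ C * m ^ k
  card_le : ∀ k, (#(level k N) : ℝ) ≤ C * m ^ k

/-- The weight is the limit `W` of the population martingale of the subtree above a vertex. -/
lemma ae_exists_isTypical {q : PMF ℕ} {B : ℕ} (hq : ∀ k, B < k → q k = 0) (hq0 : q 0 = 0)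
    (hq1 : q 1 ≠ 1) :
    ∀ᵐ N ∂galtonWatsonMeasure q, ∃ w C, IsTypical (mean q) N w C := by
  have hmean := one_lt_mean hq hq0 hq1
  have h1 : ∀ᵐ N ∂galtonWatsonMeasure q, ∀ u, 0 < martingaleLimit q (subtree u N) :=
    ae_all_iff.2 fun u => (measurePreserving_subtree q u).quasiMeasurePreserving.ae
      (ae_martingaleLimit_pos hq hq0 hq1)
  have h2 : ∀ᵐ N ∂galtonWatsonMeasure q, ∀ u, mean q * martingaleLimit q (subtree u N) =
      ∑ i ∈ range (subtree u N []), martingaleLimit q (subtree [i] (subtree u N)) :=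
    ae_all_iff.2 fun u => (measurePreserving_subtree q u).quasiMeasurePreserving.ae
      (ae_martingaleLimit_recursion hq hmean)
  filter_upwards [h1, h2, ae_exists_sum_sq_le hq hmean] with N h1 h2 ⟨C, hC⟩
  refine ⟨fun u => martingaleLimit q (subtree u N), C, h1, fun u => ?_, fun k => ?_, fun k => ?_⟩
  · rw [h2]
    simp [subtree_append, subtree]
  · have := (hC k).1
    rwa [iterate_branchSum_eq_sum_level] at this
  · have := (hC k).2
    rwa [population_eq_card_level] at this

/-! ### Base `b` expansions and cubes -/

section digits

variable {b d : ℕ}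

/-- The real number in `[0, 1]` with base `b` digits `x`. -/
noncomputable def digitSum (b : ℕ) (x : ℕ → Fin b) : ℝ :=
  ∑' n : ℕ, ((b : ℝ) ^ (n + 1))⁻¹ * ((x n : ℕ) : ℝ)

lemma digit_term_le (hb : 1 < b) (x : ℕ → Fin b) (n : ℕ) :
    ((b : ℝ) ^ (n + 1))⁻¹ * ((x n : ℕ) : ℝ) ≤ ((b : ℝ) - 1) / b * ((b : ℝ)⁻¹) ^ n := by
  have hb0 : (0 : ℝ) < b := by positivity
  have hx : ((x n : ℕ) : ℝ) ≤ b - 1 := by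
    have : (x n : ℕ) + 1 ≤ b := (x n).isLt
    have : ((x n : ℕ) : ℝ) + 1 ≤ b := by exact_mod_cast this
    linarith
  have : ((b : ℝ) - 1) / b * ((b : ℝ)⁻¹) ^ n = ((b : ℝ) ^ (n + 1))⁻¹ * (b - 1) := by
    rw [pow_succ, inv_pow]; field_simp
  rw [this]
  gcongr

lemma hasSum_digit_bound (hb : 1 < b) :
    HasSum (fun n : ℕ => ((b : ℝ) - 1) / b * ((b : ℝ)⁻¹) ^ n) 1 := by
  have hb1 : (1 : ℝ) < b := by exact_mod_cast hb
  have hb0 : (0 : ℝ) < b := by positivity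
  have h := (hasSum_geometric_of_lt_one (r := (b : ℝ)⁻¹) (by positivity)
    (inv_lt_one_of_one_lt₀ hb1)).mul_left (((b : ℝ) - 1) / b)
  have hne : (b : ℝ) - 1 ≠ 0 := by linarith
  have : ((b : ℝ) - 1) / b * (1 - (b : ℝ)⁻¹)⁻¹ = 1 := by
    have h2 : 1 - (b : ℝ)⁻¹ = (b - 1) / b := by field_simp
    rw [h2]; field_simp
  rwa [this] at h

lemma summable_digits (hb : 1 < b) (x : ℕ → Fin b) :
    Summable fun n : ℕ => ((b : ℝ) ^ (n + 1))⁻¹ * ((x n : ℕ) : ℝ) :=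
  Summable.of_nonneg_of_le (fun n => by positivity) (digit_term_le hb x)
    (hasSum_digit_bound hb).summable

lemma digitSum_nonneg (x : ℕ → Fin b) : 0 ≤ digitSum b x :=
  tsum_nonneg fun n => by positivity

lemma digitSum_le_one (hb : 1 < b) (x : ℕ → Fin b) : digitSum b x ≤ 1 := by
  rw [← (hasSum_digit_bound hb).tsum_eq]
  exact (summable_digits hb x).tsum_le_tsum (digit_term_le hb x) (hasSum_digit_bound hb).summable

lemma mul_digitSum (hb : 1 < b) (x : ℕ → Fin b) :
    b * digitSum b x = (x 0 : ℕ) + digitSum b (fun n => x (n + 1)) := by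
  have hb0 : (b : ℝ) ≠ 0 := by positivity
  rw [digitSum, (summable_digits hb x).tsum_eq_zero_add, mul_add, digitSum, ← tsum_mul_left]
  congr 1
  · simp [hb0]
  · refine tsum_congr fun n => ?_
    rw [pow_succ (b : ℝ) (n + 1)]
    field_simp

lemma digitMap_apply (ω : ℕ → Fin d → Fin b) (i : Fin d) :
    digitMap b d ω i = digitSum b (fun n => ω n i) := rfl

/-- The integer corner of the `b`-adic cube, scaled by `bⁿ`, whose points have expansions starting
with the word `w` of length `n`. -/
def cubeIndex (b : ℕ) {d : ℕ} (w : List (Fin d → Fin b)) : Fin d → ℕ :=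
  w.foldl (fun k a i => b * k i + a i) 0

lemma cubeIndex_append (w : List (Fin d → Fin b)) (a : Fin d → Fin b) (i : Fin d) :
    cubeIndex b (w ++ [a]) i = b * cubeIndex b w i + a i := by
  simp [cubeIndex]

lemma cubeIndex_injective {w w' : List (Fin d → Fin b)} (hlen : w.length = w'.length)
    (h : cubeIndex b w = cubeIndex b w') : w = w' := by
  induction w using List.reverseRecOn generalizing w' with
  | nil => exact (List.length_eq_zero_iff.1 hlen.symm).symm
  | append_singleton w a ih =>
    rcases List.eq_nil_or_concat w' with rfl | ⟨v, c, rfl⟩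
    · simp at hlen
    · rw [List.concat_eq_append] at *
      have hi : ∀ i, cubeIndex b w i = cubeIndex b v i ∧ a i = c i := fun i => by
        have h1 := congrFun h i
        rw [cubeIndex_append, cubeIndex_append] at h1
        have ha := (a i).isLt
        have hc := (c i).isLt
        have hb0 : 0 < b := by omega
        have hmod := congrArg (· % b) h1
        simp only [Nat.mul_add_mod, Nat.mod_eq_of_lt ha, Nat.mod_eq_of_lt hc] at hmod
        refine ⟨?_, Fin.ext hmod⟩
        rw [hmod] at h1
        exact Nat.eq_of_mul_eq_mul_left hb0 (by omega)
      have h1 := ih (by simpa using hlen) (funext fun i => (hi i).1)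
      rw [h1, show a = c from funext fun i => (hi i).2]

lemma ofFn_succ_eq_append {α : Type*} (x : ℕ → α) (n : ℕ) :
    List.ofFn (fun i : Fin (n + 1) => x i) = List.ofFn (fun i : Fin n => x i) ++ [x n] := by
  rw [List.ofFn_succ', List.concat_eq_append]
  simp

lemma pow_mul_digitMap (hb : 1 < b) (ω : ℕ → Fin d → Fin b) (n : ℕ) (i : Fin d) :
    (b : ℝ) ^ n * digitMap b d ω i =
      cubeIndex b (List.ofFn fun j : Fin n => ω j) i + digitSum b (fun k => ω (n + k) i) := by
  induction n with
  | zero => simp [digitMap_apply, cubeIndex]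
  | succ n ih =>
    rw [pow_succ', mul_assoc, ih, mul_add, mul_digitSum hb, ofFn_succ_eq_append,
      cubeIndex_append]
    push_cast
    simp only [add_zero, add_assoc, add_comm 1]

/-- The closed cube of side `b⁻ⁿ` with corner `b⁻ⁿ k`. -/
def cube (b : ℕ) {d : ℕ} (n : ℕ) (k : Fin d → ℕ) : Set (EuclideanSpace ℝ (Fin d)) :=
  {x | ∀ i, (b : ℝ) ^ n * x i ∈ Set.Icc (k i : ℝ) (k i + 1)}

lemma digitMap_mem_cube (hb : 1 < b) (ω : ℕ → Fin d → Fin b) (n : ℕ) :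
    digitMap b d ω ∈ cube b n (cubeIndex b (List.ofFn fun j : Fin n => ω j)) := by
  intro i
  rw [pow_mul_digitMap hb]
  exact ⟨by linarith [digitSum_nonneg fun k => ω (n + k) i],
    by linarith [digitSum_le_one hb fun k => ω (n + k) i]⟩

lemma measurableSet_cube (n : ℕ) (k : Fin d → ℕ) : MeasurableSet (cube b n k) := by
  have : cube b n k = ⋂ i, (fun x : EuclideanSpace ℝ (Fin d) => (b : ℝ) ^ n * x i) ⁻¹'
      Set.Icc (k i : ℝ) (k i + 1) := by
    ext x; simp [cube]
  rw [this]
  refine MeasurableSet.iInter fun i => ?_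
  have : Measurable fun x : EuclideanSpace ℝ (Fin d) => (b : ℝ) ^ n * x i := by fun_prop
  exact this measurableSet_Icc

/-- Since `d ≤ bᵈ`, cubes of side `b⁻⁽ⁿ⁺ᵈ⁾` have diameter at most `b⁻ⁿ`. -/
lemma dist_le_of_mem_cube (hb : 1 < b) {n : ℕ} {k : Fin d → ℕ}
    {x y : EuclideanSpace ℝ (Fin d)} (hx : x ∈ cube b (n + d) k) (hy : y ∈ cube b (n + d) k) :
    dist x y ≤ ((b : ℝ) ^ n)⁻¹ := by
  have hb0 : (0 : ℝ) < b := by positivity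
  have hcoord : ∀ i, |x i - y i| ≤ ((b : ℝ) ^ (n + d))⁻¹ := fun i => by
    have h1 := hx i
    have h2 := hy i
    have hp : (0 : ℝ) < (b : ℝ) ^ (n + d) := by positivity
    rw [← mul_le_mul_iff_right₀ hp, mul_inv_cancel₀ hp.ne', ← abs_of_pos hp, ← abs_mul,
      abs_le]
    constructor <;> nlinarith [h1.1, h1.2, h2.1, h2.2]
  have hd : (d : ℝ) ≤ (b : ℝ) ^ d := by exact_mod_cast (Nat.lt_pow_self hb).le
  have hd2 : (d : ℝ) ≤ ((b : ℝ) ^ d) ^ 2 := by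
    have : (1 : ℝ) ≤ (b : ℝ) ^ d := one_le_pow₀ (by exact_mod_cast hb.le)
    nlinarith
  rw [EuclideanSpace.dist_eq]
  refine Real.sqrt_le_iff.2 ⟨by positivity, ?_⟩
  calc ∑ i, dist (x i) (y i) ^ 2 ≤ ∑ _i : Fin d, ((b : ℝ) ^ (n + d))⁻¹ ^ 2 := by
        refine Finset.sum_le_sum fun i _ => ?_
        rw [Real.dist_eq]
        gcongr
        exact hcoord i
    _ = d * ((b : ℝ) ^ (n + d))⁻¹ ^ 2 := by simp
    _ ≤ ((b : ℝ) ^ d) ^ 2 * ((b : ℝ) ^ (n + d))⁻¹ ^ 2 := by gcongr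
    _ = ((b : ℝ) ^ n)⁻¹ ^ 2 := by rw [pow_add]; field_simp

/-- Two cube corners at distance at most `2` in every coordinate. -/
def IsClose {d : ℕ} (k l : Fin d → ℕ) : Prop := ∀ i, k i ≤ l i + 2 ∧ l i ≤ k i + 2

lemma isClose_of_dist_le {n : ℕ} (hb : 1 < b) {k l : Fin d → ℕ}
    {x y : EuclideanSpace ℝ (Fin d)} (hx : x ∈ cube b n k) (hy : y ∈ cube b n l)
    (h : dist x y ≤ ((b : ℝ) ^ n)⁻¹) : IsClose k l := by
  intro i
  have hp : (0 : ℝ) < (b : ℝ) ^ n := by positivity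
  have h1 : |x i - y i| ≤ ((b : ℝ) ^ n)⁻¹ := by
    refine le_trans ?_ h
    rw [← Real.dist_eq, EuclideanSpace.dist_eq]
    refine Real.le_sqrt_of_sq_le ?_
    exact Finset.single_le_sum (f := fun i => dist (x i) (y i) ^ 2)
      (fun _ _ => sq_nonneg _) (Finset.mem_univ i)
  have h2 : |(b : ℝ) ^ n * x i - (b : ℝ) ^ n * y i| ≤ 1 := by
    rw [← mul_sub, abs_mul, abs_of_pos hp, ← mul_inv_cancel₀ hp.ne']
    gcongr
  obtain ⟨h3, h4⟩ := abs_le.1 h2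
  have hx' := hx i
  have hy' := hy i
  have e1 : (k i : ℝ) ≤ l i + 2 := by linarith [hx'.1, hy'.2]
  have e2 : (l i : ℝ) ≤ k i + 2 := by linarith [hy'.1, hx'.2]
  exact ⟨by exact_mod_cast e1, by exact_mod_cast e2⟩

lemma IsClose.symm {k l : Fin d → ℕ} (h : IsClose k l) : IsClose l k := fun i => (h i).symm

open Classical in
lemma card_filter_isClose_le {α : Type*} (s : Finset α) (κ : α → Fin d → ℕ)
    (hκ : Set.InjOn κ s) (k : Fin d → ℕ) : #{u ∈ s | IsClose k (κ u)} ≤ 5 ^ d := by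
  calc #{u ∈ s | IsClose k (κ u)}
      ≤ #(Fintype.piFinset fun i => Finset.Icc (k i - 2) (k i + 2)) := by
        refine Finset.card_le_card_of_injOn κ ?_ (hκ.mono fun u hu => (Finset.mem_filter.1 hu).1)
        intro u hu
        have h := (Finset.mem_filter.1 hu).2
        simp only [Finset.mem_coe, Fintype.mem_piFinset, Finset.mem_Icc]
        intro i
        have := h i
        omega
    _ ≤ 5 ^ d := by
        rw [Fintype.card_piFinset]
        calc ∏ i, #(Finset.Icc (k i - 2) (k i + 2)) ≤ ∏ _i : Fin d, 5 :=
              Finset.prod_le_prod' fun i _ => by rw [Nat.card_Icc]; omega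
          _ = 5 ^ d := by simp

open Classical in
/-- A bilinear form supported on pairs of close cubes is at most `5ᵈ` times the diagonal one. -/
lemma sum_isClose_le {α : Type*} (s : Finset α) (κ : α → Fin d → ℕ)
    (hκ : Set.InjOn κ s) (a : α → ℝ) :
    ∑ u ∈ s, ∑ v ∈ s with IsClose (κ u) (κ v), a u * a v ≤ 5 ^ d * ∑ u ∈ s, a u ^ 2 := by
  have hcard : ∀ u, (#{v ∈ s | IsClose (κ u) (κ v)} : ℝ) ≤ 5 ^ d := fun u => by
    exact_mod_cast card_filter_isClose_le s κ hκ (κ u)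
  have h1 : ∑ u ∈ s, ∑ v ∈ s with IsClose (κ u) (κ v), a u ^ 2 ≤ 5 ^ d * ∑ u ∈ s, a u ^ 2 := by
    rw [Finset.mul_sum]
    refine Finset.sum_le_sum fun u _ => ?_
    rw [Finset.sum_const, nsmul_eq_mul]
    gcongr
    exact hcard u
  have h2 : ∑ u ∈ s, ∑ v ∈ s with IsClose (κ u) (κ v), a v ^ 2 =
      ∑ u ∈ s, ∑ v ∈ s with IsClose (κ u) (κ v), a u ^ 2 := by
    simp only [Finset.sum_filter]
    rw [Finset.sum_comm]
    refine Finset.sum_congr rfl fun u _ => Finset.sum_congr rfl fun v _ => ?_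
    have : IsClose (κ v) (κ u) ↔ IsClose (κ u) (κ v) := ⟨IsClose.symm, IsClose.symm⟩
    simp [this]
  have h3 : ∑ u ∈ s, ∑ v ∈ s with IsClose (κ u) (κ v), a u * a v ≤
      ∑ u ∈ s, ∑ v ∈ s with IsClose (κ u) (κ v), (a u ^ 2 / 2 + a v ^ 2 / 2) := by
    refine Finset.sum_le_sum fun u _ => Finset.sum_le_sum fun v _ => ?_
    nlinarith [sq_nonneg (a u - a v)]
  refine h3.trans ?_
  simp only [Finset.sum_add_distrib, ← Finset.sum_div]
  rw [h2]
  linarith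

end digits

/-! ### Embedded trees -/

section embedding

variable {α : Type*} {N : List ℕ → ℕ} {φ : List ℕ → List α}

lemma mem_familyTree_of_append {u v : List ℕ} (h : u ++ v ∈ familyTree N) : u ∈ familyTree N :=
  fun w i hw => h w i (hw.trans (List.prefix_append u v))

lemma append_singleton_mem_familyTree {u : List ℕ} {i : ℕ} (hu : u ∈ familyTree N)
    (hi : i < N u) : u ++ [i] ∈ familyTree N := by
  intro w j hw
  rcases List.prefix_concat_iff.1 hw with h | h
  · obtain ⟨rfl, h2⟩ := List.append_inj' h rfl
    simp only [List.cons.injEq, and_true] at h2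
    rwa [h2]
  · exact hu w j h

lemma IsTreeEmbedding.length_eq (hφ : IsTreeEmbedding (familyTree N) φ) {u : List ℕ}
    (hu : u ∈ familyTree N) : (φ u).length = u.length := by
  induction u using List.reverseRecOn with
  | nil => simp [hφ.map_root]
  | append_singleton u i ih =>
    obtain ⟨a, ha⟩ := hφ.map_child u i hu
    rw [ha, List.length_append, List.length_append, ih (mem_familyTree_of_append hu)]
    rfl

end embedding

/-! ### Positive capacity implies summability -/

section lower

variable {E : Type*} [MetricSpace E] [MeasurableSpace E] [BorelSpace E]
  [SecondCountableTopology E]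

lemma measurable_measure_closedBall (θ : Measure E) [SFinite θ] (r : ℝ) :
    Measurable fun x => θ (Metric.closedBall x r) := by
  have h : MeasurableSet {p : E × E | dist p.1 p.2 ≤ r} :=
    (isClosed_le (by fun_prop) continuous_const).measurableSet
  convert! measurable_measure_prodMk_left (ν := θ) h using 3 with x
  ext y
  simp [dist_comm]

/-- If `n` sets of diameter at most `r` carry the probability measure `θ`, then two independent
points with law `θ` are within distance `r` with probability at least `1 / n`. -/
lemma inv_card_le_lintegral_closedBall {ι : Type*} (s : Finset ι) (A : ι → Set E)
    (hA : ∀ v ∈ s, MeasurableSet (A v)) {r : ℝ}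
    (hr : ∀ v ∈ s, ∀ x ∈ A v, ∀ y ∈ A v, dist x y ≤ r) (θ : Measure E) [IsProbabilityMeasure θ]
    (hθ : ∀ᵐ x ∂θ, ∃ v ∈ s, x ∈ A v) :
    (#s : ℝ≥0∞)⁻¹ ≤ ∫⁻ x, θ (Metric.closedBall x r) ∂θ := by
  set f : E → ℝ≥0∞ := fun x => θ (Metric.closedBall x r) with hf
  have hfm : Measurable f := measurable_measure_closedBall θ r
  -- By the covering, `∫ 1 / f ≤ n`; then Jensen's inequality, through its tangent line at `1 / n`.
  have h1 : ∫⁻ x, (f x)⁻¹ ∂θ ≤ #s := by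
    calc ∫⁻ x, (f x)⁻¹ ∂θ
        ≤ ∫⁻ x, ∑ v ∈ s, (A v).indicator (fun _ => (θ (A v))⁻¹) x ∂θ := by
          refine lintegral_mono_ae ?_
          filter_upwards [hθ] with x ⟨v, hv, hx⟩
          refine le_trans ?_ (Finset.single_le_sum (f := fun v =>
            (A v).indicator (fun _ => (θ (A v))⁻¹) x) (fun _ _ => zero_le) hv)
          simp only [Set.indicator_of_mem hx]
          refine ENNReal.inv_le_inv.2 (measure_mono fun y hy => ?_)
          exact hr v hv y hy x hx
      _ = ∑ v ∈ s, (θ (A v))⁻¹ * θ (A v) := by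
          rw [lintegral_finsetSum' _ fun v hv =>
            (measurable_const.indicator (hA v hv)).aemeasurable]
          refine Finset.sum_congr rfl fun v hv => ?_
          rw [lintegral_indicator_const (hA v hv)]
      _ ≤ ∑ _v ∈ s, 1 := Finset.sum_le_sum fun v _ => ENNReal.inv_mul_le_one _
      _ = #s := by simp
  have hs : #s ≠ 0 := by
    obtain ⟨x, v, hv, _⟩ := hθ.exists
    exact (Finset.card_pos.2 ⟨v, hv⟩).ne'
  set a : ℝ≥0∞ := (#s : ℝ≥0∞)⁻¹ with ha
  have ha_top : a ≠ ⊤ := by simp [ha, hs]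
  have hpt : ∀ x, 2 * a ≤ f x + a ^ 2 * (f x)⁻¹ := fun x => by
    have hft : f x ≠ ⊤ := measure_ne_top _ _
    rcases eq_or_ne (f x) 0 with h0 | h0
    · have : a ^ 2 ≠ 0 := by simp [ha]
      simp [h0, ENNReal.mul_top this]
    · have hfp := ENNReal.toReal_pos h0 hft
      rw [← ENNReal.ofReal_toReal ha_top, ← ENNReal.ofReal_toReal hft,
        ← ENNReal.ofReal_inv_of_pos hfp, ← ENNReal.ofReal_pow ENNReal.toReal_nonneg,
        ← ENNReal.ofReal_mul (by positivity), ← ENNReal.ofReal_add (by positivity) (by positivity),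
        show (2 : ℝ≥0∞) = ENNReal.ofReal 2 by simp, ← ENNReal.ofReal_mul (by norm_num)]
      refine ENNReal.ofReal_le_ofReal ?_
      set u := (f x).toReal
      set c := a.toReal
      have : u + c ^ 2 * u⁻¹ - 2 * c = (u - c) ^ 2 * u⁻¹ := by field_simp; ring
      have : 0 ≤ (u - c) ^ 2 * u⁻¹ := by positivity
      linarith
  have h2 : 2 * a ≤ ∫⁻ x, f x ∂θ + a := by
    calc 2 * a = ∫⁻ _x, 2 * a ∂θ := by simp
      _ ≤ ∫⁻ x, (f x + a ^ 2 * (f x)⁻¹) ∂θ := lintegral_mono hpt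
      _ = ∫⁻ x, f x ∂θ + a ^ 2 * ∫⁻ x, (f x)⁻¹ ∂θ := by
          rw [lintegral_add_left hfm,
            lintegral_const_mul _ (show Measurable fun x => (f x)⁻¹ from hfm.inv)]
      _ ≤ ∫⁻ x, f x ∂θ + a ^ 2 * #s := by gcongr
      _ = ∫⁻ x, f x ∂θ + a := by
          rw [sq, mul_assoc, ha, ENNReal.inv_mul_cancel (by simpa using hs) (by simp), mul_one]
  rw [two_mul] at h2
  exact (ENNReal.add_le_add_iff_right ha_top).1 h2

/-- Layer-cake lower bound for a decreasing kernel along the scales `ρ₁ ≥ ρ₂ ≥ …`. -/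
lemma sum_increment_le_gaugeKernel {g : ℝ → ℝ} (hg : IsGauge g) {ρ : ℕ → ℝ} (hρ : Antitone ρ)
    (hρ0 : ∀ n, 0 < ρ n) {r : ℝ} (hr : 0 ≤ r) (M : ℕ) :
    ∑ n ∈ range M, ENNReal.ofReal (g (ρ (n + 1)) - g (ρ n)) *
      (if r ≤ ρ (n + 1) then 1 else 0) ≤ gaugeKernel g r := by
  rcases hr.eq_or_lt with rfl | hr
  · simp [gaugeKernel]
  have hmono : ∀ n, g (ρ n) ≤ g (ρ (n + 1)) := fun n =>
    hg.antitoneOn (hρ0 _) (hρ0 _) (hρ n.le_succ)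
  have htel : ∀ M, ∑ n ∈ range M, ENNReal.ofReal (g (ρ (n + 1)) - g (ρ n)) =
      ENNReal.ofReal (g (ρ M) - g (ρ 0)) := fun M => by
    rw [← ENNReal.ofReal_sum_of_nonneg fun n _ => sub_nonneg.2 (hmono n),
      Finset.sum_range_sub (fun n => g (ρ n))]
  induction M with
  | zero => simp
  | succ M ih =>
    by_cases h : r ≤ ρ (M + 1)
    · calc ∑ n ∈ range (M + 1), ENNReal.ofReal (g (ρ (n + 1)) - g (ρ n)) *
            (if r ≤ ρ (n + 1) then 1 else 0)
          ≤ ∑ n ∈ range (M + 1), ENNReal.ofReal (g (ρ (n + 1)) - g (ρ n)) := by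
            refine Finset.sum_le_sum fun n _ => ?_
            split_ifs <;> simp
        _ = ENNReal.ofReal (g (ρ (M + 1)) - g (ρ 0)) := htel _
        _ ≤ gaugeKernel g r := by
            rw [gaugeKernel, if_neg hr.ne']
            refine ENNReal.ofReal_le_ofReal ?_
            have h1 := hg.antitoneOn (Set.mem_Ioi.2 hr) (Set.mem_Ioi.2 (hρ0 (M + 1))) h
            have h2 := hg.pos _ (hρ0 0)
            linarith
    · rw [Finset.sum_range_succ, if_neg h, mul_zero, add_zero]
      exact ih

lemma sum_increment_le_energy {g : ℝ → ℝ} (hg : IsGauge g) {ρ : ℕ → ℝ} (hρ : Antitone ρ)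
    (hρ0 : ∀ n, 0 < ρ n) (θ : Measure E) [IsProbabilityMeasure θ] (M : ℕ) :
    ∑ n ∈ range M, ENNReal.ofReal (g (ρ (n + 1)) - g (ρ n)) *
      ∫⁻ x, θ (Metric.closedBall x (ρ (n + 1))) ∂θ ≤ energy g θ := by
  have hin : ∀ x, ∑ n ∈ range M, ENNReal.ofReal (g (ρ (n + 1)) - g (ρ n)) *
      θ (Metric.closedBall x (ρ (n + 1))) ≤ ∫⁻ y, gaugeKernel g (dist x y) ∂θ := fun x => by
    have hm : ∀ n, MeasurableSet (Metric.closedBall x (ρ (n + 1))) := fun n =>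
      Metric.isClosed_closedBall.measurableSet
    calc ∑ n ∈ range M, ENNReal.ofReal (g (ρ (n + 1)) - g (ρ n)) *
          θ (Metric.closedBall x (ρ (n + 1)))
        = ∫⁻ y, ∑ n ∈ range M, ENNReal.ofReal (g (ρ (n + 1)) - g (ρ n)) *
            (Metric.closedBall x (ρ (n + 1))).indicator 1 y ∂θ := by
          rw [lintegral_finsetSum _ fun n _ => (measurable_one.indicator (hm n)).const_mul _]
          refine Finset.sum_congr rfl fun n _ => ?_
          rw [lintegral_const_mul _ (measurable_one.indicator (hm n)),
            lintegral_indicator_one (hm n)]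
      _ ≤ ∫⁻ y, gaugeKernel g (dist x y) ∂θ := by
          refine lintegral_mono fun y => ?_
          refine le_trans (le_of_eq ?_)
            (sum_increment_le_gaugeKernel hg hρ hρ0 (dist_nonneg (x := x) (y := y)) M)
          refine Finset.sum_congr rfl fun n _ => ?_
          congr 1
          by_cases h : dist x y ≤ ρ (n + 1)
          · rw [if_pos h, Set.indicator_of_mem (by rwa [Metric.mem_closedBall, dist_comm]),
              Pi.one_apply]
          · rw [if_neg h, Set.indicator_of_notMem (by rwa [Metric.mem_closedBall, dist_comm])]
  refine le_trans (le_of_eq ?_) (lintegral_mono hin)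
  rw [lintegral_finsetSum _ fun n _ => (measurable_measure_closedBall θ _).const_mul _]
  refine Finset.sum_congr rfl fun n _ => ?_
  rw [lintegral_const_mul _ (measurable_measure_closedBall θ _)]

end lower

/-- Summation by parts. -/
lemma summable_of_sum_increment_le {m K : ℝ} (hm : 1 < m) {a : ℕ → ℝ} (ha : ∀ n, 0 ≤ a n)
    (h : ∀ M, ∑ n ∈ range M, (m ^ (n + 1))⁻¹ * (a (n + 1) - a n) ≤ K) :
    Summable fun n => (m ^ (n + 1))⁻¹ * a (n + 1) := by
  have hm0 : 0 < m := by linarith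
  have hid : ∀ M, (1 - m⁻¹) * ∑ n ∈ range M, (m ^ (n + 1))⁻¹ * a (n + 1) + (m ^ (M + 1))⁻¹ * a M =
      ∑ n ∈ range M, (m ^ (n + 1))⁻¹ * (a (n + 1) - a n) + m⁻¹ * a 0 := fun M => by
    induction M with
    | zero => simp
    | succ M ih =>
      rw [Finset.sum_range_succ, Finset.sum_range_succ, mul_add]
      have : (m ^ (M + 1 + 1))⁻¹ = m⁻¹ * (m ^ (M + 1))⁻¹ := by
        rw [pow_succ _ (M + 1), mul_inv]; ring
      rw [this]
      linear_combination ih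
  have hpos : 0 < 1 - m⁻¹ := by
    have := inv_lt_one_of_one_lt₀ hm
    linarith
  refine summable_of_sum_range_le (c := (K + m⁻¹ * a 0) / (1 - m⁻¹))
    (fun n => mul_nonneg (by positivity) (ha _)) fun M => ?_
  rw [le_div_iff₀ hpos, mul_comm]
  have h1 := hid M
  have h2 := h M
  have h3 : 0 ≤ (m ^ (M + 1))⁻¹ * a M := mul_nonneg (by positivity) (ha _)
  linarith

section
variable {b d : ℕ} {m C : ℝ} {N : List ℕ → ℕ} {w : List ℕ → ℝ}
  {φ : List ℕ → List (Fin d → Fin b)}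

lemma antitone_inv_pow (hb : 1 < b) : Antitone fun n : ℕ => ((b : ℝ) ^ n)⁻¹ := fun i j hij => by
  have h1 : (1 : ℝ) ≤ b := by exact_mod_cast hb.le
  have : (0 : ℝ) < b := by positivity
  simp only
  gcongr

lemma IsTypical.one_le (hN : IsTypical m N w C) : 1 ≤ C := by
  simpa [level] using hN.card_le 0

/-- Generation `n` of the tree provides a cover of its boundary set by cubes of side `b⁻ⁿ`. -/
lemma exists_mem_cube (hb : 1 < b) (hφ : IsTreeEmbedding (familyTree N) φ)
    {ω : ℕ → Fin d → Fin b} (hω : ω ∈ boundary (φ '' familyTree N)) (n : ℕ) :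
    ∃ v ∈ level n N, digitMap b d ω ∈ cube b n (cubeIndex b (φ v)) := by
  obtain ⟨v, hv, hvω⟩ := hω n
  refine ⟨v, mem_level.2 ⟨hv, ?_⟩, ?_⟩
  · rw [← hφ.length_eq hv, hvω, List.length_ofFn]
  · rw [hvω]; exact digitMap_mem_cube hb ω n

theorem summable_of_energy_ne_top (hb : 1 < b) (hm : 1 < m) (hN : IsTypical m N w C)
    (hφ : IsTreeEmbedding (familyTree N) φ) {g : ℝ → ℝ} (hg : IsGauge g)
    (θ : Measure (EuclideanSpace ℝ (Fin d))) [IsProbabilityMeasure θ]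
    (hθ : θ (digitMap b d '' boundary (φ '' familyTree N)) = 1) (hE : energy g θ ≠ ⊤) :
    Summable fun n : ℕ => (m ^ (n + 1))⁻¹ * g (((b : ℝ) ^ (n + 1))⁻¹) := by
  have hm0 : 0 < m := by linarith
  have hC0 : 0 < C := by linarith [hN.one_le]
  have hρ0 : ∀ n : ℕ, 0 < ((b : ℝ) ^ n)⁻¹ := fun n => by positivity
  have hcover : ∀ n : ℕ, ∀ᵐ x ∂θ, ∃ v ∈ level (n + d) N,
      x ∈ cube b (n + d) (cubeIndex b (φ v)) := fun n => by
    have hU : MeasurableSet (⋃ v ∈ level (n + d) N, cube b (n + d) (cubeIndex b (φ v))) :=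
      Finset.measurableSet_biUnion _ fun v _ => measurableSet_cube _ _
    have h1 : θ (⋃ v ∈ level (n + d) N, cube b (n + d) (cubeIndex b (φ v))) = 1 := by
      refine le_antisymm prob_le_one (hθ.symm.le.trans (measure_mono ?_))
      rintro _ ⟨ω, hω, rfl⟩
      simpa using exists_mem_cube hb hφ hω (n + d)
    have h2 := (prob_compl_eq_zero_iff hU).2 h1
    filter_upwards [measure_eq_zero_iff_ae_notMem.1 h2] with x hx
    simpa using hx
  have hball : ∀ n : ℕ, ENNReal.ofReal ((C * m ^ (n + d))⁻¹) ≤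
      ∫⁻ x, θ (Metric.closedBall x (((b : ℝ) ^ n)⁻¹)) ∂θ := fun n => by
    refine le_trans ?_ (inv_card_le_lintegral_closedBall (level (n + d) N)
      (fun v => cube b (n + d) (cubeIndex b (φ v))) (fun v _ => measurableSet_cube _ _)
      (fun v _ x hx y hy => dist_le_of_mem_cube hb hx hy) θ (hcover n))
    rw [ENNReal.ofReal_inv_of_pos (by positivity), ENNReal.inv_le_inv,
      ← ENNReal.ofReal_natCast]
    exact ENNReal.ofReal_le_ofReal (hN.card_le _)
  have hmono : ∀ n : ℕ, 0 ≤ g (((b : ℝ) ^ (n + 1))⁻¹) - g (((b : ℝ) ^ n)⁻¹) := fun n =>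
    sub_nonneg.2 (hg.antitoneOn (hρ0 _) (hρ0 _) (antitone_inv_pow hb n.le_succ))
  refine summable_of_sum_increment_le (K := C * m ^ d * (energy g θ).toReal) hm
    (a := fun n => g (((b : ℝ) ^ n)⁻¹)) (fun n => (hg.pos _ (hρ0 n)).le) fun M => ?_
  have h := sum_increment_le_energy hg (antitone_inv_pow hb) hρ0 θ M
  have h1 : ENNReal.ofReal (∑ n ∈ range M, (g (((b : ℝ) ^ (n + 1))⁻¹) - g (((b : ℝ) ^ n)⁻¹)) *
      (C * m ^ (n + 1 + d))⁻¹) ≤ energy g θ := by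
    refine le_trans ?_ h
    rw [ENNReal.ofReal_sum_of_nonneg fun n _ => mul_nonneg (hmono n) (by positivity)]
    refine Finset.sum_le_sum fun n _ => ?_
    rw [ENNReal.ofReal_mul (hmono n)]
    gcongr
    exact hball (n + 1)
  have h2 := (ENNReal.ofReal_le_iff_le_toReal hE).1 h1
  calc ∑ n ∈ range M, (m ^ (n + 1))⁻¹ * (g (((b : ℝ) ^ (n + 1))⁻¹) - g (((b : ℝ) ^ n)⁻¹))
      = C * m ^ d * ∑ n ∈ range M, (g (((b : ℝ) ^ (n + 1))⁻¹) - g (((b : ℝ) ^ n)⁻¹)) *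
          (C * m ^ (n + 1 + d))⁻¹ := by
        rw [Finset.mul_sum]
        refine Finset.sum_congr rfl fun n _ => ?_
        rw [pow_add m (n + 1) d]
        field_simp
    _ ≤ C * m ^ d * (energy g θ).toReal := by gcongr

end

/-! ### Random paths -/

section path

/-- The path from the root that at every vertex `v` moves on to the child number `c v`. -/
def pathVertex (c : List ℕ → ℕ) : ℕ → List ℕ
  | 0 => []
  | n + 1 => pathVertex c n ++ [c (pathVertex c n)]

lemma length_pathVertex (c : List ℕ → ℕ) (n : ℕ) : (pathVertex c n).length = n := by
  induction n with
  | zero => rfl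
  | succ n ih => simp [pathVertex, ih]

lemma pathVertex_succ_eq_iff (c : List ℕ → ℕ) (u : List ℕ) (i : ℕ) :
    pathVertex c (u ++ [i]).length = u ++ [i] ↔ pathVertex c u.length = u ∧ c u = i := by
  rw [List.length_append, List.length_singleton, pathVertex]
  constructor
  · intro h
    obtain ⟨h1, h2⟩ := List.append_inj' h rfl
    simp only [List.cons.injEq, and_true] at h2
    rw [h1] at h2
    exact ⟨h1, h2⟩
  · rintro ⟨h1, h2⟩
    rw [h1, h2]

variable {m C : ℝ} {N : List ℕ → ℕ} {w : List ℕ → ℝ}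

/-- The law of the child chosen at `u`: proportional to the weight of the child. -/
noncomputable def childLaw (hN : IsTypical m N w C) (hm : 0 < m) (u : List ℕ) : PMF ℕ :=
  PMF.ofFinset (fun i => if i < N u then ENNReal.ofReal (w (u ++ [i]) / (m * w u)) else 0)
    (range (N u)) (by
      rw [Finset.sum_congr rfl fun i hi => if_pos (Finset.mem_range.1 hi),
        ← ENNReal.ofReal_sum_of_nonneg fun i _ =>
          div_nonneg (hN.pos _).le (mul_nonneg hm.le (hN.pos _).le),
        ← Finset.sum_div, ← hN.harmonic, div_self (mul_pos hm (hN.pos u)).ne',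
        ENNReal.ofReal_one])
    fun i hi => if_neg fun h => hi (Finset.mem_range.2 h)

lemma childLaw_apply (hN : IsTypical m N w C) (hm : 0 < m) (u : List ℕ) (i : ℕ) :
    childLaw hN hm u i = if i < N u then ENNReal.ofReal (w (u ++ [i]) / (m * w u)) else 0 := rfl

lemma childLaw_singleton_le (hN : IsTypical m N w C) (hm : 0 < m) (u : List ℕ) (i : ℕ) :
    (childLaw hN hm u).toMeasure {i} ≤ ENNReal.ofReal (w (u ++ [i]) / (m * w u)) := by
  rw [PMF.toMeasure_apply_singleton _ _ (measurableSet_singleton _), childLaw_apply]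
  split_ifs <;> simp

lemma ae_childLaw_lt (hN : IsTypical m N w C) (hm : 0 < m) (u : List ℕ) :
    ∀ᵐ i ∂(childLaw hN hm u).toMeasure, i < N u := by
  have : {i | ¬ i < N u} = ⋃ i ∈ {i | ¬ i < N u}, {i} := by ext; simp
  rw [ae_iff, this, measure_biUnion_null_iff (Set.to_countable _)]
  intro i hi
  rw [PMF.toMeasure_apply_singleton _ _ (measurableSet_singleton _), childLaw_apply, if_neg hi]

/-- The law of independent choices of a child at every vertex. -/
noncomputable def choiceMeasure (hN : IsTypical m N w C) (hm : 0 < m) : Measure (List ℕ → ℕ) :=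
  Measure.infinitePi fun u => (childLaw hN hm u).toMeasure

instance (hN : IsTypical m N w C) (hm : 0 < m) : IsProbabilityMeasure (choiceMeasure hN hm) := by
  unfold choiceMeasure; infer_instance

lemma ae_choice_lt (hN : IsTypical m N w C) (hm : 0 < m) :
    ∀ᵐ c ∂choiceMeasure hN hm, ∀ u, c u < N u :=
  ae_all_iff.2 fun u => (measurePreserving_eval_infinitePi
    (fun u => (childLaw hN hm u).toMeasure) u).quasiMeasurePreserving.ae (ae_childLaw_lt hN hm u)

/-- The event that the random path passes through `u` prescribes the choices at the proper prefixes
of `u` only, so that its probability is a product which telescopes. There is equality for `u` in the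
tree, while the path almost surely avoids every other word. -/
lemma exists_box_pathVertex (hN : IsTypical m N w C) (hm : 0 < m) (u : List ℕ) :
    ∃ (s : Finset (List ℕ)) (t : List ℕ → Set ℕ), (∀ v ∈ s, v.length < u.length) ∧
      {c | pathVertex c u.length = u} = Set.pi s t ∧
      ∏ v ∈ s, (childLaw hN hm v).toMeasure (t v) ≤
        ENNReal.ofReal (w u / (m ^ u.length * w [])) := by
  classical
  induction u using List.reverseRecOn with
  | nil =>
    refine ⟨∅, fun _ => Set.univ, by simp, by simp [pathVertex], ?_⟩
    simp [div_self (hN.pos []).ne']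
  | append_singleton u i ih =>
    obtain ⟨s, t, hs, hst, hprod⟩ := ih
    have hu : u ∉ s := fun h => (hs u h).ne rfl
    have hne : ∀ v ∈ s, v ≠ u := fun v hv h => hu (h ▸ hv)
    refine ⟨insert u s, Function.update t u {i}, ?_, ?_, ?_⟩
    · intro v hv
      rw [List.length_append, List.length_singleton]
      rcases Finset.mem_insert.1 hv with rfl | hv
      · omega
      · have := hs v hv; omega
    · ext c
      have h1 : pathVertex c u.length = u ↔ c ∈ Set.pi (s : Set (List ℕ)) t := by
        rw [← hst]; rfl
      change pathVertex c (u ++ [i]).length = u ++ [i] ↔ _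
      rw [pathVertex_succ_eq_iff, h1]
      simp only [Set.mem_pi, Finset.mem_coe, Finset.mem_insert, forall_eq_or_imp,
        Function.update_self, Set.mem_singleton_iff]
      rw [and_comm]
      refine and_congr_right fun _ => forall₂_congr fun v hv => ?_
      rw [Function.update_of_ne (hne v hv)]
    · rw [Finset.prod_insert hu, Function.update_self, Finset.prod_congr rfl fun v hv => by
        rw [Function.update_of_ne (hne v hv)]]
      have hw := hN.pos u
      have hw0 := hN.pos []
      refine (mul_le_mul' (childLaw_singleton_le hN hm u i) hprod).trans (le_of_eq ?_)
      rw [← ENNReal.ofReal_mul (div_nonneg (hN.pos _).le (by positivity))]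
      congr 1
      rw [List.length_append, List.length_singleton, pow_succ]
      field_simp

lemma measurableSet_pathVertex_eq (hN : IsTypical m N w C) (hm : 0 < m) (n : ℕ) (u : List ℕ) :
    MeasurableSet {c | pathVertex c n = u} := by
  by_cases hu : u.length = n
  · obtain ⟨s, t, -, h, -⟩ := exists_box_pathVertex hN hm u
    rw [← hu, h]
    exact MeasurableSet.pi s.countable_toSet fun _ _ => .of_discrete
  · convert MeasurableSet.empty using 1
    ext c
    simp only [Set.mem_ofPred_eq, Set.mem_empty_iff_false, iff_false]
    rintro rfl
    exact hu (length_pathVertex c n)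

lemma measure_pathVertex_le (hN : IsTypical m N w C) (hm : 0 < m) {n : ℕ} {u : List ℕ}
    (hu : u.length = n) : choiceMeasure hN hm {c | pathVertex c n = u} ≤
      ENNReal.ofReal (w u / (m ^ n * w [])) := by
  obtain ⟨s, t, -, h, hle⟩ := exists_box_pathVertex hN hm u
  rw [← hu, h, choiceMeasure, Measure.infinitePi_pi _ fun _ _ => .of_discrete]
  exact hle

lemma pathVertex_mem_level {c : List ℕ → ℕ} (hc : ∀ u, c u < N u) (n : ℕ) :
    pathVertex c n ∈ level n N := by
  refine mem_level.2 ⟨?_, length_pathVertex c n⟩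
  induction n with
  | zero => exact nil_mem_familyTree N
  | succ n ih => exact append_singleton_mem_familyTree ih (hc _)

end path

section point

variable {b d : ℕ} {m C : ℝ} {N : List ℕ → ℕ} {w : List ℕ → ℝ}
  {φ : List ℕ → List (Fin d → Fin b)}

/-- The infinite word onto which `φ` maps the path with choices `c`; the default letter `a` is never
used when the path stays in the tree. -/
def pathWord (φ : List ℕ → List (Fin d → Fin b)) (a : Fin d → Fin b) (c : List ℕ → ℕ) (n : ℕ) :
    Fin d → Fin b :=
  (φ (pathVertex c (n + 1))).getD n a

lemma ofFn_pathWord (hφ : IsTreeEmbedding (familyTree N) φ) (a : Fin d → Fin b) {c : List ℕ → ℕ}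
    (hc : ∀ u, c u < N u) (n : ℕ) :
    List.ofFn (fun j : Fin n => pathWord φ a c j) = φ (pathVertex c n) := by
  induction n with
  | zero => simp [pathVertex, hφ.map_root]
  | succ n ih =>
    have h1 := (mem_level.1 (pathVertex_mem_level hc n)).1
    obtain ⟨e, he⟩ := hφ.map_child (pathVertex c n) (c (pathVertex c n))
      (append_singleton_mem_familyTree h1 (hc _))
    have hlen : (φ (pathVertex c n)).length = n := by
      rw [hφ.length_eq h1, length_pathVertex]
    rw [ofFn_succ_eq_append, ih]
    change φ (pathVertex c n) ++ [pathWord φ a c n] =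
      φ (pathVertex c n ++ [c (pathVertex c n)])
    rw [he]
    congr 2
    change (φ (pathVertex c n ++ [c (pathVertex c n)])).getD n a = e
    rw [he, List.getD_append_right _ _ _ _ hlen.le, hlen]
    simp

lemma pathWord_mem_boundary (hφ : IsTreeEmbedding (familyTree N) φ) (a : Fin d → Fin b)
    {c : List ℕ → ℕ} (hc : ∀ u, c u < N u) :
    pathWord φ a c ∈ boundary (φ '' familyTree N) := fun n => by
  rw [ofFn_pathWord hφ a hc]
  exact ⟨_, (mem_level.1 (pathVertex_mem_level hc n)).1, rfl⟩

lemma measurable_digitMap_pathWord (hN : IsTypical m N w C) (hm : 0 < m)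
    (φ : List ℕ → List (Fin d → Fin b)) (a : Fin d → Fin b) :
    Measurable fun c => digitMap b d (pathWord φ a c) := by
  let _ : MeasurableSpace (List ℕ) := ⊤
  have hv : ∀ n, Measurable fun c => pathVertex c n := fun n =>
    measurable_to_countable' fun u => measurableSet_pathVertex_eq hN hm n u
  have hcoord : Measurable fun c => fun i : Fin d => digitMap b d (pathWord φ a c) i := by
    refine measurable_pi_iff.2 fun i => ?_
    refine Measurable.tsum fun n => Measurable.const_mul ?_ _
    have : Measurable fun u : List ℕ => ((((φ u).getD n a) i : ℕ) : ℝ) := measurable_from_top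
    exact this.comp (hv (n + 1))
  exact (PiLp.continuous_toLp 2 _).measurable.comp hcoord

/-- Layer-cake upper bound for a decreasing kernel. -/
lemma gaugeKernel_le_tsum (hb : 1 < b) {g : ℝ → ℝ} (hg : IsGauge g) {r : ℝ} (hr : 0 ≤ r) :
    gaugeKernel g r ≤ ENNReal.ofReal (g 1) + ∑' n : ℕ,
      ENNReal.ofReal (g (((b : ℝ) ^ (n + 1))⁻¹)) * (if r ≤ ((b : ℝ) ^ n)⁻¹ then 1 else 0) := by
  have hb1 : (1 : ℝ) < b := by exact_mod_cast hb
  have hb0 : (0 : ℝ) < b := by positivity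
  rcases hr.eq_or_lt with rfl | hr
  · have hle : ∑' _n : ℕ, ENNReal.ofReal (g 1) ≤ ∑' n : ℕ,
        ENNReal.ofReal (g (((b : ℝ) ^ (n + 1))⁻¹)) *
          (if (0 : ℝ) ≤ ((b : ℝ) ^ n)⁻¹ then 1 else 0) := by
      refine ENNReal.tsum_le_tsum fun n => ?_
      rw [if_pos (by positivity), mul_one]
      refine ENNReal.ofReal_le_ofReal (hg.antitoneOn (Set.mem_Ioi.2 (by positivity))
        (Set.mem_Ioi.2 one_pos) ?_)
      exact inv_le_one_of_one_le₀ (one_le_pow₀ hb1.le)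
    rw [ENNReal.tsum_const_eq_top_of_ne_zero
      (by simpa using hg.pos 1 one_pos), top_le_iff] at hle
    rw [hle]
    simp
  rw [gaugeKernel, if_neg hr.ne']
  rcases le_or_gt 1 r with h1 | h1
  · exact le_add_right (ENNReal.ofReal_le_ofReal
      (hg.antitoneOn (Set.mem_Ioi.2 one_pos) (Set.mem_Ioi.2 hr) h1))
  · obtain ⟨n, hn1, hn2⟩ := exists_nat_pow_near_of_lt_one hr h1.le (inv_pos.2 hb0)
      (inv_lt_one_of_one_lt₀ hb1)
    rw [inv_pow] at hn1 hn2
    refine le_add_left (le_trans ?_ (ENNReal.le_tsum n))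
    rw [if_pos hn2, mul_one]
    exact ENNReal.ofReal_le_ofReal
      (hg.antitoneOn (Set.mem_Ioi.2 (by positivity)) (Set.mem_Ioi.2 hr) hn1.le)

open Classical in
/-- The indicator that the paths with choices `c` and `c'` pass through vertices of generation `n`
of the tree whose cubes are close, written as a sum over the pairs of such vertices. -/
noncomputable def closeIndicator (b : ℕ) (N : List ℕ → ℕ) (φ : List ℕ → List (Fin d → Fin b))
    (n : ℕ) (c c' : List ℕ → ℕ) : ℝ≥0∞ :=
  ∑ u ∈ level n N, ∑ v ∈ level n N with IsClose (cubeIndex b (φ u)) (cubeIndex b (φ v)),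
    {c | pathVertex c n = u}.indicator 1 c * {c | pathVertex c n = v}.indicator 1 c'

lemma one_le_closeIndicator (hb : 1 < b) (hφ : IsTreeEmbedding (familyTree N) φ)
    (a : Fin d → Fin b) {c c' : List ℕ → ℕ} (hc : ∀ u, c u < N u) (hc' : ∀ u, c' u < N u) (n : ℕ)
    (h : dist (digitMap b d (pathWord φ a c)) (digitMap b d (pathWord φ a c')) ≤
      ((b : ℝ) ^ n)⁻¹) : 1 ≤ closeIndicator b N φ n c c' := by
  classical
  have h1 := digitMap_mem_cube hb (pathWord φ a c) n
  have h2 := digitMap_mem_cube hb (pathWord φ a c') n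
  rw [ofFn_pathWord hφ a hc] at h1
  rw [ofFn_pathWord hφ a hc'] at h2
  have hcl := isClose_of_dist_le hb h1 h2 h
  unfold closeIndicator
  refine le_trans ?_ (Finset.single_le_sum (fun _ _ => zero_le) (pathVertex_mem_level hc n))
  refine le_trans ?_ (Finset.single_le_sum (fun _ _ => zero_le)
    (Finset.mem_filter.2 ⟨pathVertex_mem_level hc' n, hcl⟩))
  simp

lemma measurable_closeIndicator (hN : IsTypical m N w C) (hm : 0 < m)
    (φ : List ℕ → List (Fin d → Fin b)) (n : ℕ) :
    Measurable fun p : (List ℕ → ℕ) × (List ℕ → ℕ) => closeIndicator b N φ n p.1 p.2 := by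
  have hmeas : ∀ u, Measurable ({c | pathVertex c n = u}.indicator (1 : (List ℕ → ℕ) → ℝ≥0∞)) :=
    fun u => measurable_one.indicator (measurableSet_pathVertex_eq hN hm n u)
  unfold closeIndicator
  exact Finset.measurable_sum _ fun u _ => Finset.measurable_sum _ fun v _ =>
    ((hmeas u).comp measurable_fst).mul ((hmeas v).comp measurable_snd)

lemma measurable_closeIndicator_right (hN : IsTypical m N w C) (hm : 0 < m)
    (φ : List ℕ → List (Fin d → Fin b)) (n : ℕ) (c : List ℕ → ℕ) :
    Measurable fun c' => closeIndicator b N φ n c c' := by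
  unfold closeIndicator
  exact Finset.measurable_sum _ fun u _ => Finset.measurable_sum _ fun v _ =>
    (measurable_one.indicator (measurableSet_pathVertex_eq hN hm n v)).const_mul _

lemma lintegral_closeIndicator_le (hN : IsTypical m N w C) (hm : 0 < m)
    (hφ : IsTreeEmbedding (familyTree N) φ) (n : ℕ) :
    ∫⁻ c, ∫⁻ c', closeIndicator b N φ n c c' ∂choiceMeasure hN hm ∂choiceMeasure hN hm ≤
      ENNReal.ofReal (5 ^ d * C / w [] ^ 2 * (m ^ n)⁻¹) := by
  classical
  have hmeas : ∀ u, Measurable ({c | pathVertex c n = u}.indicator (1 : (List ℕ → ℕ) → ℝ≥0∞)) :=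
    fun u => measurable_one.indicator (measurableSet_pathVertex_eq hN hm n u)
  have hint : ∀ u, ∫⁻ c, {c | pathVertex c n = u}.indicator 1 c ∂choiceMeasure hN hm =
      choiceMeasure hN hm {c | pathVertex c n = u} := fun u =>
    lintegral_indicator_one (measurableSet_pathVertex_eq hN hm n u)
  have hw0 := hN.pos []
  have hpos : ∀ u, 0 ≤ w u / (m ^ n * w []) := fun u => div_nonneg (hN.pos u).le (by positivity)
  have hinj : Set.InjOn (fun u => cubeIndex b (φ u)) (level n N : Set (List ℕ)) := by
    intro u hu v hv huv
    obtain ⟨hu1, hu2⟩ := mem_level.1 hu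
    obtain ⟨hv1, hv2⟩ := mem_level.1 hv
    exact hφ.injOn hu1 hv1 (cubeIndex_injective
      (by rw [hφ.length_eq hu1, hφ.length_eq hv1, hu2, hv2]) huv)
  calc ∫⁻ c, ∫⁻ c', closeIndicator b N φ n c c' ∂choiceMeasure hN hm ∂choiceMeasure hN hm
      = ∑ u ∈ level n N, ∑ v ∈ level n N with IsClose (cubeIndex b (φ u)) (cubeIndex b (φ v)),
          choiceMeasure hN hm {c | pathVertex c n = u} *
            choiceMeasure hN hm {c | pathVertex c n = v} := by
        have hin : ∀ c, ∫⁻ c', closeIndicator b N φ n c c' ∂choiceMeasure hN hm =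
            ∑ u ∈ level n N, ∑ v ∈ level n N with IsClose (cubeIndex b (φ u)) (cubeIndex b (φ v)),
              {c | pathVertex c n = u}.indicator 1 c *
                choiceMeasure hN hm {c | pathVertex c n = v} := fun c => by
          unfold closeIndicator
          rw [lintegral_finsetSum _ fun u _ => Finset.measurable_sum _ fun v _ =>
            (hmeas v).const_mul _]
          refine Finset.sum_congr rfl fun u _ => ?_
          rw [lintegral_finsetSum _ fun v _ => (hmeas v).const_mul _]
          refine Finset.sum_congr rfl fun v _ => ?_
          rw [lintegral_const_mul _ (hmeas v), hint]
        simp_rw [hin]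
        rw [lintegral_finsetSum _ fun u _ => Finset.measurable_sum _ fun v _ =>
            (hmeas u).mul_const _]
        refine Finset.sum_congr rfl fun u _ => ?_
        rw [lintegral_finsetSum _ fun v _ => (hmeas u).mul_const _]
        refine Finset.sum_congr rfl fun v _ => ?_
        rw [lintegral_mul_const _ (hmeas u), hint]
    _ ≤ ∑ u ∈ level n N, ∑ v ∈ level n N with IsClose (cubeIndex b (φ u)) (cubeIndex b (φ v)),
          ENNReal.ofReal (w u / (m ^ n * w []) * (w v / (m ^ n * w []))) := by
        refine Finset.sum_le_sum fun u hu => Finset.sum_le_sum fun v hv => ?_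
        rw [ENNReal.ofReal_mul (hpos u)]
        exact mul_le_mul' (measure_pathVertex_le hN hm (mem_level.1 hu).2)
          (measure_pathVertex_le hN hm (mem_level.1 (Finset.mem_filter.1 hv).1).2)
    _ = ENNReal.ofReal (∑ u ∈ level n N,
          ∑ v ∈ level n N with IsClose (cubeIndex b (φ u)) (cubeIndex b (φ v)),
            w u / (m ^ n * w []) * (w v / (m ^ n * w []))) := by
        rw [ENNReal.ofReal_sum_of_nonneg fun u _ => Finset.sum_nonneg fun v _ =>
          mul_nonneg (hpos u) (hpos v)]
        refine Finset.sum_congr rfl fun u _ => ?_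
        rw [ENNReal.ofReal_sum_of_nonneg fun v _ => mul_nonneg (hpos u) (hpos v)]
    _ ≤ ENNReal.ofReal (5 ^ d * C / w [] ^ 2 * (m ^ n)⁻¹) := by
        refine ENNReal.ofReal_le_ofReal ((sum_isClose_le _ _ hinj _).trans ?_)
        have hsum : ∑ u ∈ level n N, (w u / (m ^ n * w [])) ^ 2 =
            (∑ u ∈ level n N, w u ^ 2) / (m ^ n * w []) ^ 2 := by
          rw [Finset.sum_div]
          exact Finset.sum_congr rfl fun u _ => div_pow _ _ _
        rw [hsum]
        calc 5 ^ d * ((∑ u ∈ level n N, w u ^ 2) / (m ^ n * w []) ^ 2)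
            ≤ 5 ^ d * (C * m ^ n / (m ^ n * w []) ^ 2) := by
              gcongr
              exact hN.sum_sq_le n
          _ = 5 ^ d * C / w [] ^ 2 * (m ^ n)⁻¹ := by field_simp

theorem exists_energy_ne_top (hb : 1 < b) (hm : 1 < m) (hN : IsTypical m N w C)
    (hφ : IsTreeEmbedding (familyTree N) φ) {g : ℝ → ℝ} (hg : IsGauge g)
    (hs : Summable fun n : ℕ => (m ^ (n + 1))⁻¹ * g (((b : ℝ) ^ (n + 1))⁻¹)) :
    ∃ θ : Measure (EuclideanSpace ℝ (Fin d)), IsProbabilityMeasure θ ∧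
      θ (digitMap b d '' boundary (φ '' familyTree N)) = 1 ∧ energy g θ ≠ ⊤ := by
  have hm0 : 0 < m := by linarith
  have hC0 : 0 < C := by linarith [hN.one_le]
  have hw0 := hN.pos []
  set a : Fin d → Fin b := fun _ => ⟨0, by omega⟩
  set X : (List ℕ → ℕ) → EuclideanSpace ℝ (Fin d) := fun c => digitMap b d (pathWord φ a c) with hX
  have hXm : Measurable X := measurable_digitMap_pathWord hN hm0 φ a
  set P := choiceMeasure hN hm0 with hP
  have hgood : ∀ᵐ c ∂P, ∀ u, c u < N u := ae_choice_lt hN hm0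
  have hprob : IsProbabilityMeasure (P.map X) := Measure.isProbabilityMeasure_map hXm.aemeasurable
  refine ⟨P.map X, hprob, ?_, ?_⟩
  · refine le_antisymm prob_le_one ?_
    refine le_trans ?_ (Measure.le_map_apply hXm.aemeasurable _)
    have : P (X ⁻¹' (digitMap b d '' boundary (φ '' familyTree N))) = 1 := by
      rw [← measure_univ (μ := P)]
      refine measure_congr ?_
      filter_upwards [hgood] with c hc
      exact propext ⟨fun _ => trivial, fun _ => ⟨_, pathWord_mem_boundary hφ a hc, rfl⟩⟩
    exact this.symm.le
  · set γ : ℕ → ℝ≥0∞ := fun n => ENNReal.ofReal (g (((b : ℝ) ^ (n + 1))⁻¹)) with hγ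
    have hgpos : ∀ n : ℕ, 0 < g (((b : ℝ) ^ (n + 1))⁻¹) := fun n => hg.pos _ (by positivity)
    have hcm1 : ∀ n c, Measurable fun c' => closeIndicator b N φ n c c' := fun n c =>
      measurable_closeIndicator_right hN hm0 φ n c
    have hcm2 : ∀ n, Measurable fun c => ∫⁻ c', closeIndicator b N φ n c c' ∂P := fun n =>
      (measurable_closeIndicator hN hm0 φ n).lintegral_prod_right'
    have hfin : energy g (P.map X) ≤ ENNReal.ofReal (g 1) +
        ∑' n, ENNReal.ofReal (g (((b : ℝ) ^ (n + 1))⁻¹) *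
          (5 ^ d * C / w [] ^ 2 * (m ^ n)⁻¹)) := by
      calc energy g (P.map X)
          ≤ ∫⁻ c, ∫⁻ y, gaugeKernel g (dist (X c) y) ∂P.map X ∂P := lintegral_map_le _ _
        _ ≤ ∫⁻ c, ∫⁻ c', gaugeKernel g (dist (X c) (X c')) ∂P ∂P :=
            lintegral_mono fun c => lintegral_map_le _ _
        _ ≤ ∫⁻ c, ∫⁻ c', (ENNReal.ofReal (g 1) +
              ∑' n, γ n * closeIndicator b N φ n c c') ∂P ∂P := by
            refine lintegral_mono_ae ?_
            filter_upwards [hgood] with c hc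
            refine lintegral_mono_ae ?_
            filter_upwards [hgood] with c' hc'
            refine (gaugeKernel_le_tsum hb hg dist_nonneg).trans ?_
            gcongr with n
            split_ifs with h
            · exact one_le_closeIndicator hb hφ a hc hc' n h
            · exact zero_le
        _ = ENNReal.ofReal (g 1) +
              ∑' n, γ n * ∫⁻ c, ∫⁻ c', closeIndicator b N φ n c c' ∂P ∂P := by
            have hin : ∀ c, ∫⁻ c', (ENNReal.ofReal (g 1) +
                ∑' n, γ n * closeIndicator b N φ n c c') ∂P = ENNReal.ofReal (g 1) +
                ∑' n, γ n * ∫⁻ c', closeIndicator b N φ n c c' ∂P := fun c => by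
              rw [lintegral_add_left measurable_const, lintegral_const, measure_univ, mul_one,
                lintegral_tsum fun n => ((hcm1 n c).const_mul _).aemeasurable]
              congr 1
              exact tsum_congr fun n => lintegral_const_mul _ (hcm1 n c)
            simp_rw [hin]
            rw [lintegral_add_left measurable_const, lintegral_const, measure_univ, mul_one,
              lintegral_tsum fun n => ((hcm2 n).const_mul _).aemeasurable]
            congr 1
            exact tsum_congr fun n => lintegral_const_mul _ (hcm2 n)
        _ ≤ _ := by
            gcongr with n
            rw [ENNReal.ofReal_mul (hgpos n).le]
            gcongr
            exact lintegral_closeIndicator_le hN hm0 hφ n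
    refine ne_top_of_le_ne_top (ENNReal.add_ne_top.2 ⟨ENNReal.ofReal_ne_top, ?_⟩) hfin
    refine Summable.tsum_ofReal_ne_top ?_
    refine (hs.mul_left (5 ^ d * C / w [] ^ 2 * m)).congr fun n => ?_
    rw [pow_succ m n]
    field_simp

end point

/-- A set has positive capacity exactly when it carries a probability measure of finite energy. -/
lemma capacity_pos_iff {E : Type*} [MetricSpace E] [MeasurableSpace E] {g : ℝ → ℝ} {L : Set E} :
    0 < capacity g L ↔
      ∃ θ : Measure E, IsProbabilityMeasure θ ∧ θ L = 1 ∧ energy g θ ≠ ⊤ := by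
  rw [capacity, ENNReal.inv_pos, Ne, iInf_eq_top, not_forall]
  simp only [iInf_eq_top, not_forall, exists_prop, Ne]

end GaltonWatson

theorem corollary4p2 (b d : ℕ) (hb : 1 < b) (q : PMF ℕ) (hq0 : q 0 = 0) (hq1 : q 1 ≠ 1)
    (hq : ∀ k : ℕ, b ^ d < k → q k = 0) :
    ∀ᵐ N ∂(GaltonWatson.galtonWatsonMeasure q),
      ∀ φ : List ℕ → List (Fin d → Fin b),
        GaltonWatson.IsTreeEmbedding (GaltonWatson.familyTree N) φ →
        ∀ L : Set (EuclideanSpace ℝ (Fin d)),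
          L = GaltonWatson.digitMap b d ''
            GaltonWatson.boundary (φ '' GaltonWatson.familyTree N) →
          (∀ x ∈ L, ∀ i : Fin d, x i ∈ Set.Icc (0 : ℝ) 1) ∧
          ∀ g : ℝ → ℝ, GaltonWatson.IsGauge g →
            (0 < GaltonWatson.capacity g L ↔
              Summable fun n : ℕ =>
                (GaltonWatson.mean q ^ (n + 1))⁻¹ * g (((b : ℝ) ^ (n + 1))⁻¹)) := by
  have hmean := GaltonWatson.one_lt_mean hq hq0 hq1
  filter_upwards [GaltonWatson.ae_exists_isTypical hq hq0 hq1] with N ⟨w, C, hN⟩ φ hφ L hL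
  subst hL
  refine ⟨?_, fun g hg => ?_⟩
  · rintro _ ⟨ω, -, rfl⟩ i
    exact ⟨GaltonWatson.digitSum_nonneg _, GaltonWatson.digitSum_le_one hb _⟩
  · rw [GaltonWatson.capacity_pos_iff]
    constructor
    · rintro ⟨θ, hθ, hθL, hE⟩
      exact GaltonWatson.summable_of_energy_ne_top hb hmean hN hφ hg θ hθL hE
    · exact GaltonWatson.exists_energy_ne_top hb hmean hN hφ hg
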